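/- **Setting.** Let $\mathcal S$ be a finite-dimensional real vector space with inner product $\langle\cdot,\cdot\rangle$ and Euclidean norm $\|\cdot\|_2$, endowed also with an arbitrary norm $\|\cdot\|$, with dual norm $\|G\|_\star=\sup_{\|Z\|\le 1}\langle G,Z\rangle$. Let $\underline\rho,\bar\rho>0$ satisfy $\underline\rho\|X\|\le\|X\|_2\le\bar\rho\|X\|$ for all $X\in\mathcal S$. Let $n\ge 1$, $f=\frac1n\sum_{j=1}^n f_j$ with $f_j:\mathcal S\to\mathbb R$ differentiable, and assume: * $f(X)\ge f^\star$ for all $X$, for some $f^\star\in\mathbb R$; * $\|\nabla f(X)-\nabla f(Y)\|_\star\le L\|X-Y\|$ and $\|\nabla f_j(X)-\nabla f_j(Y)\|_\star\le L_j\|X-Y\|$ for all $X,Y$ and $j$, where $L,L_j\ge 0$; put $\tilde L^2=\frac1n\sum_j L_j^2$; * the stochastic gradients $\nabla f_j(X;\xi_j)$, $\xi_j\sim\mathcal D_j$, satisfy $\mathbb E[\nabla f_j(X;\xi_j)]=\nabla f_j(X)$ and $\mathbb E\|\nabla f_j(X;\xi_j)-\nabla f_j(X)\|_2^2\le\sigma^2$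 for all $X$ and $j$, where $\sigma\ge0$. The compressors are randomized maps $\mathcal C^k,\mathcal C_j^k:\mathcal S\to\mathcal S$ with $\mathbb E\|\mathcal C^k(X)-X\|^2\le(1-\alpha_P)\|X\|^2$ (that is, $\mathcal C^k\in\mathbb B(\alpha_P)$) and $\mathbb E\|\mathcal C_j^k(X)-X\|_2^2\le(1-\alpha_D)\|X\|_2^2$ (that is, $\mathcal C_j^k\in\mathbb B_2(\alpha_D)$) for all $X$, where $\alpha_P,\alpha_D\in(0,1]$. **Algorithm (single-block EF21-Muon).** Fix $\beta\in(0,1]$, $\gamma>0$ and $X^0\in\mathcal S$, and start from $W^0=X^0$ and $G_j^0=M_j^0=\nabla f_j(X^0;\xi_j^0)$. With $G^k=\frac1n\sum_j G_j^k$, iterate for $k=0,1,2,\dots$ $$X^{k+1}\in\operatorname*{argmin}_{\|Z-X^k\|\le\gamma\|G^k\|_\star}\langle G^k,Z\rangle\quad\bigl(\text{equivalently } X^{k+1}=X^k-\gamma (G^k)^\sharp,\ G^\sharp\in\operatorname*{argmax}_{Z\in\mathcal S}\{\langle G,Z\rangle-\tfrac12\|Z\|^2\}\bigr),$$ $$W^{k+1}=W^k+\mathcal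 C^k(X^{k+1}-W^k),$$ $$M_j^{k+1}=(1-\beta)M_j^k+\beta\nabla f_j(W^{k+1};\xi_j^{k+1}),\qquad G_j^{k+1}=G_j^k+\mathcal C_j^k(M_j^{k+1}-G_j^k).$$ All samples $\xi_j^k\sim\mathcal D_j$, the randomness of the server compressors $\mathcal C^k$ ($k\ge0$) and that of the worker compressors $(\mathcal C_j^k)_{j}$ ($k\ge0$) are mutually independent; within one iteration $k$ the compressors $\mathcal C_1^k,\dots,\mathcal C_n^k$ may be dependent on each other. If the minimizer is not unique, $X^{k+1}$ is any minimizer chosen as a measurable function of the randomness used before. **Theorem.** Let $$\zeta=\frac{\bar\rho^2}{\underline\rho^2}\left(\frac{12}{\beta^2}L^2+\frac{24(\beta+2)}{\alpha_P^2}L^2+\frac{36(\beta^2+4)}{\alpha_D^2}\tilde L^2+\frac{144\beta^2(2\beta+5)}{\alpha_P^2\alpha_D^2}\tilde L^2\right)$$ and suppose that $\gamma>0$ and $\gamma\,(2\sqrt\zeta+2L)\le1$. Then for every $K\ge1$ the random variables $\|\nabla f(X^k)\|_\star^2$, $0\le k<K$, are integrable and, with $\delta^0=f(X^0)-f^\star$,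 $$\frac1K\sum_{k=0}^{K-1}\mathbb E\|\nabla f(X^k)\|_\star^2\le\frac{4\delta^0}{K\gamma}+\frac{24}{K}\left(\frac{1}{n\beta}+\frac{12\beta}{\alpha_D^2}\right)\sigma^2\bar\rho^2+24\left(\frac1n+\frac{(1-\alpha_D)\beta}{\alpha_D}+\frac{12\beta^2}{\alpha_D^2}\right)\sigma^2\bar\rho^2\beta.$$ -/

import Mathlib

open MeasureTheory ProbabilityTheory

namespace EF21Muon

section Geometry

variable {S : Type*} [NormedAddCommGroup S] [InnerProductSpace ℝ S]

/-- The dual norm `‖G‖⋆ = sup {⟨G, Z⟩ : ‖Z‖ ≤ 1}` of the norm `N`; the inner product of `S` is the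
Euclidean (trace) one and its norm `‖·‖` is the Euclidean norm `‖·‖₂`. -/
noncomputable def dualNorm (N : Seminorm ℝ S) (G : S) : ℝ :=
  sSup ((fun Z : S => inner ℝ G Z) '' {Z : S | N Z ≤ 1})

/-- The set of values of the linear minimization oracle:
`argmin {⟨G, Z⟩ : Z ∈ B(X, t)}` with `B(X, t) = {Z : N (Z - X) ≤ t}`. -/
def lmo (N : Seminorm ℝ S) (X : S) (t : ℝ) (G : S) : Set S :=
  {Z : S | N (Z - X) ≤ t ∧ ∀ Y : S, N (Y - X) ≤ t → inner ℝ G Z ≤ inner ℝ G Y}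

/-- `h` is differentiable and `L`-smooth with respect to `N`:
`‖∇h(X) - ∇h(Y)‖⋆ ≤ L ‖X - Y‖`. -/
def IsSmooth [CompleteSpace S] (N : Seminorm ℝ S) (L : ℝ) (h : S → ℝ) : Prop :=
  Differentiable ℝ h ∧
    ∀ X Y : S, dualNorm N (gradient h X - gradient h Y) ≤ L * N (X - Y)

/-- The global objective `f = (1/n) ∑ⱼ fⱼ`. -/
noncomputable def objective {n : ℕ} (f : Fin n → S → ℝ) (X : S) : ℝ :=
  (n : ℝ)⁻¹ * ∑ j, f j X

/-- A randomized mapping `C : S → S`, written as a jointly measurable function of the input and of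
a random seed with law `ν`, is a contractive compressor with parameter `α ∈ (0, 1]` with respect to
`N`: `E[N(C(X) - X)²] ≤ (1 - α) N(X)²` for all `X`. -/
def IsCompressor [MeasurableSpace S] (N : Seminorm ℝ S) (α : ℝ) {U : Type*} [MeasurableSpace U]
    (ν : Measure U) (C : S → U → S) : Prop :=
  Measurable (fun p : S × U => C p.1 p.2) ∧
    ∀ X : S, ∫⁻ u, ENNReal.ofReal (N (C X u - X) ^ 2) ∂ν ≤ ENNReal.ofReal ((1 - α) * N X ^ 2)

/-- `g X ξ`, `ξ ∼ D`, is an unbiased stochastic gradient oracle for `h` with variance at most `σ²`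
in the Euclidean norm. -/
def IsOracle [CompleteSpace S] [MeasurableSpace S] (σ : ℝ) {Ξ : Type*} [MeasurableSpace Ξ]
    (D : Measure Ξ) (h : S → ℝ) (g : S → Ξ → S) : Prop :=
  Measurable (fun p : S × Ξ => g p.1 p.2) ∧
    ∀ X : S, Integrable (g X) D ∧ ∫ z, g X z ∂D = gradient h X ∧
      ∫⁻ z, ENNReal.ofReal (‖g X z - gradient h X‖ ^ 2) ∂D ≤ ENNReal.ofReal (σ ^ 2)

end Geometry

section Randomness

variable {Ω : Type*} {n : ℕ} {Ξ : Fin n → Type*} {U V : ℕ → Type*}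
  [∀ j, MeasurableSpace (Ξ j)] [∀ k, MeasurableSpace (U k)] [∀ k, MeasurableSpace (V k)]

/-- The sources of randomness, with mutually independent values: the data samples
`ξ k j ∼ D j` (iteration `k`, worker `j`), the seeds `η k ∼ νU k` of the server compressors and the
seeds `θ k ∼ νV k` of the worker compressors. The compressors of the different workers in one
iteration are driven by one common seed, so that they may be independent (the seed is then a tuple)
or correlated. -/
structure IsRandomness [MeasurableSpace Ω] (μ : Measure Ω)
    (D : ∀ j, Measure (Ξ j)) (νU : ∀ k, Measure (U k)) (νV : ∀ k, Measure (V k))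
    (ξ : ℕ → ∀ j, Ω → Ξ j) (η : ∀ k, Ω → U k) (θ : ∀ k, Ω → V k) : Prop where
  sample_law : ∀ k j, MeasurePreserving (ξ k j) μ (D j)
  server_law : ∀ k, MeasurePreserving (η k) μ (νU k)
  worker_law : ∀ k, MeasurePreserving (θ k) μ (νV k)
  indep : iIndep
    (Sum.elim (fun p : ℕ × Fin n => MeasurableSpace.comap (ξ p.1 p.2) inferInstance)
      (Sum.elim (fun k : ℕ => MeasurableSpace.comap (η k) inferInstance)
        (fun k : ℕ => MeasurableSpace.comap (θ k) inferInstance))) μ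

/-- The information available when `X^{k+1}` is computed: the samples of the iterations
`0, …, k` and the compressor seeds of the iterations `0, …, k - 1`. -/
@[reducible] def past (ξ : ℕ → ∀ j, Ω → Ξ j) (η : ∀ k, Ω → U k) (θ : ∀ k, Ω → V k) (k : ℕ) :
    MeasurableSpace Ω :=
  (⨆ i ∈ Set.Iic k, ⨆ j, MeasurableSpace.comap (ξ i j) inferInstance) ⊔
    ((⨆ i ∈ Set.Iio k, MeasurableSpace.comap (η i) inferInstance) ⊔
      (⨆ i ∈ Set.Iio k, MeasurableSpace.comap (θ i) inferInstance))

variable {S : Type*} [NormedAddCommGroup S] [InnerProductSpace ℝ S] [MeasurableSpace S]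

/-- The server's gradient estimator `G^k = (1/n) ∑ⱼ Gⱼ^k`. -/
noncomputable def serverEstimator (G : ℕ → Fin n → Ω → S) (k : ℕ) (ω : Ω) : S :=
  (n : ℝ)⁻¹ • ∑ j, G k j ω

/-- `X, W, M, G` are the iterates of EF21-Muon (single block) with momentum `β`, stepsize `γ`
(that is, LMO radius `t^k = γ ‖G^k‖⋆`), stochastic gradients `g j`, server compressors `C k`, worker
compressors `Cw k j`, started from `W⁰ = X⁰` and `Gⱼ⁰ = Mⱼ⁰ = ∇fⱼ(X⁰; ξⱼ⁰)`. The minimizer in the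
LMO step need not be unique; `X^{k+1}` is any minimizer that depends measurably on the past. -/
structure IsRun (N : Seminorm ℝ S) (β γ : ℝ) (X₀ : S) (g : ∀ j, S → Ξ j → S)
    (C : ∀ k, S → U k → S) (Cw : ∀ k, Fin n → S → V k → S)
    (ξ : ℕ → ∀ j, Ω → Ξ j) (η : ∀ k, Ω → U k) (θ : ∀ k, Ω → V k)
    (X W : ℕ → Ω → S) (M G : ℕ → Fin n → Ω → S) : Prop where
  X_zero : ∀ ω, X 0 ω = X₀
  W_zero : ∀ ω, W 0 ω = X₀
  M_zero : ∀ j ω, M 0 j ω = g j X₀ (ξ 0 j ω)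
  G_zero : ∀ j ω, G 0 j ω = g j X₀ (ξ 0 j ω)
  X_meas : ∀ k, Measurable[past ξ η θ k] (X (k + 1))
  X_succ : ∀ k ω, X (k + 1) ω ∈
    lmo N (X k ω) (γ * dualNorm N (serverEstimator G k ω)) (serverEstimator G k ω)
  W_succ : ∀ k ω, W (k + 1) ω = W k ω + C k (X (k + 1) ω - W k ω) (η k ω)
  M_succ : ∀ k j ω, M (k + 1) j ω =
    (1 - β) • M k j ω + β • g j (W (k + 1) ω) (ξ (k + 1) j ω)
  G_succ : ∀ k j ω, G (k + 1) j ω = G k j ω + Cw k j (M (k + 1) j ω - G k j ω) (θ k ω)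

end Randomness

/-- The constant `ζ` in the stepsize restriction; `Lt2` stands for `L̃² = (1/n) ∑ⱼ Lⱼ²`. -/
noncomputable def zeta (ρlo ρhi β αP αD L Lt2 : ℝ) : ℝ :=
  ρhi ^ 2 / ρlo ^ 2 *
    (12 / β ^ 2 * L ^ 2 + 24 * (β + 2) / αP ^ 2 * L ^ 2 + 36 * (β ^ 2 + 4) / αD ^ 2 * Lt2
      + 144 * β ^ 2 * (2 * β + 5) / (αP ^ 2 * αD ^ 2) * Lt2)

end EF21Muon

/-! Write e for the dual-norm error of G^k as an estimate of ∇f(X^k), and d for the step length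
N(X^{k+1} - X^k). `IsSmooth.lmo_step` shows that one step lowers f by (γ/4)‖∇f(X^k)‖⋆², up to an
error (3γ/2)e², and leaves a surplus (1/(4γ) - L/2)d². Telescoping reduces the theorem to bounding
the sum of E e² by noise plus a multiple of the sum of E d² small enough for the surplus to absorb.

The error is split through the averaged momentum: ‖∇f(X) - G‖⋆ is at most `ρhi` times the Euclidean
norm of (M̄ - ∇f(X)) + (G - M̄), with M̄ the mean of the M_j. Four second moments obey linear
recursions: the server compression error w = W - X (contraction 1 - αP/2), the momentum error a of
M̄ and the mean worker momentum error m (contraction 1 - β), and the mean worker compression error b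
(contraction 1 - αD/2). They are driven by d, by one another and by the variance. Each sample is
independent of everything computed before it, so its noise is orthogonal to the rest and enters
additively as β²σ²; for M̄, independence across workers improves this to β²σ²/n. Correlated worker
compressors do no harm, because b is averaged by Cauchy-Schwarz only.

No Lyapunov function is needed: each recursion is summed over k < K (`sum_add_le_of_contraction`)
and the sums are substituted in the order w, then a and m, then b. The resulting weight of the sum
of E d² is controlled by ζ, and the stepsize condition makes the surplus dominate it
(`step_weight_le`). What remains is the noise, which `noise_bound_le` brings to the stated form. -/

namespace EF21Muon

/-! ### Dual norms, smoothness and one LMO step. -/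

section NormGeometry

variable {S : Type*} [NormedAddCommGroup S] [InnerProductSpace ℝ S]
  {N : Seminorm ℝ S} {ρlo ρhi : ℝ}

theorem inner_le_of_seminorm_le_one (hρ : 0 < ρhi) (hhi : ∀ X, ‖X‖ ≤ ρhi * N X) (G Z : S)
    (hZ : N Z ≤ 1) : inner ℝ G Z ≤ ρhi * ‖G‖ := by
  have h1 : ‖Z‖ ≤ ρhi := (hhi Z).trans (by nlinarith)
  calc inner ℝ G Z ≤ ‖G‖ * ‖Z‖ := real_inner_le_norm _ _
    _ ≤ ‖G‖ * ρhi := by gcongr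
    _ = ρhi * ‖G‖ := mul_comm _ _

theorem inner_le_dualNorm (hρ : 0 < ρhi) (hhi : ∀ X, ‖X‖ ≤ ρhi * N X) (G Z : S)
    (hZ : N Z ≤ 1) : inner ℝ G Z ≤ dualNorm N G := by
  refine le_csSup ⟨ρhi * ‖G‖, ?_⟩ ⟨Z, hZ, rfl⟩
  rintro _ ⟨Y, hY, rfl⟩
  exact inner_le_of_seminorm_le_one hρ hhi G Y hY

theorem dualNorm_le_of_forall {G : S} {c : ℝ} (h : ∀ Z, N Z ≤ 1 → inner ℝ G Z ≤ c) :
    dualNorm N G ≤ c := by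
  refine csSup_le ⟨_, 0, by simp, rfl⟩ ?_
  rintro _ ⟨Y, hY, rfl⟩
  exact h Y hY

theorem dualNorm_nonneg (hρ : 0 < ρhi) (hhi : ∀ X, ‖X‖ ≤ ρhi * N X) (G : S) :
    0 ≤ dualNorm N G := by
  simpa using inner_le_dualNorm hρ hhi G 0 (by simp)

/-- Normalize Z. The upper equivalence bound makes the seminorm definite, so the case N Z = 0 is
just Z = 0. -/
theorem inner_le_dualNorm_mul (hρ : 0 < ρhi) (hhi : ∀ X, ‖X‖ ≤ ρhi * N X) (G Z : S) :
    inner ℝ G Z ≤ dualNorm N G * N Z := by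
  rcases (apply_nonneg N Z).eq_or_lt with h0 | h0
  · have h := hhi Z
    rw [← h0, mul_zero] at h
    simp [norm_le_zero_iff.1 h]
  · have h := inner_le_dualNorm hρ hhi G ((N Z)⁻¹ • Z)
      (by rw [map_smul_eq_mul, Real.norm_of_nonneg (by positivity), inv_mul_cancel₀ h0.ne'])
    rwa [real_inner_smul_right, inv_mul_le_iff₀ h0, mul_comm] at h

theorem dualNorm_le_mul_norm (hρ : 0 < ρhi) (hhi : ∀ X, ‖X‖ ≤ ρhi * N X) (G : S) :
    dualNorm N G ≤ ρhi * ‖G‖ :=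
  dualNorm_le_of_forall fun Z hZ => inner_le_of_seminorm_le_one hρ hhi G Z hZ

/-- Pair G with itself. This converts dual-norm smoothness into Euclidean estimates, where the
variance is measured, at the price of a factor 1/ρlo. -/
theorem mul_norm_le_dualNorm (hρ : 0 < ρhi) (hlo : ∀ X, ρlo * N X ≤ ‖X‖)
    (hhi : ∀ X, ‖X‖ ≤ ρhi * N X) (hρlo : 0 < ρlo) (G : S) : ρlo * ‖G‖ ≤ dualNorm N G := by
  rcases eq_or_ne G 0 with rfl | hG
  · simpa using dualNorm_nonneg hρ hhi (0 : S)
  have h := inner_le_dualNorm_mul hρ hhi G G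
  rw [real_inner_self_eq_norm_sq] at h
  have h0 : 0 < ‖G‖ := norm_pos_iff.2 hG
  have h1 := mul_le_mul_of_nonneg_left (hlo G) (dualNorm_nonneg hρ hhi G)
  refine le_of_mul_le_mul_right ?_ h0
  nlinarith

theorem dualNorm_add_le (hρ : 0 < ρhi) (hhi : ∀ X, ‖X‖ ≤ ρhi * N X) (G H : S) :
    dualNorm N (G + H) ≤ dualNorm N G + dualNorm N H := by
  refine dualNorm_le_of_forall fun Z hZ => ?_
  rw [inner_add_left]
  exact add_le_add (inner_le_dualNorm hρ hhi G Z hZ) (inner_le_dualNorm hρ hhi H Z hZ)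

theorem continuous_dualNorm (hρ : 0 < ρhi) (hhi : ∀ X, ‖X‖ ≤ ρhi * N X) :
    Continuous (dualNorm N) := by
  refine (LipschitzWith.of_le_add_mul (Real.toNNReal ρhi) fun G H => ?_).continuous
  have h := dualNorm_add_le hρ hhi H (G - H)
  rw [add_sub_cancel] at h
  rw [Real.coe_toNNReal _ hρ.le, dist_eq_norm]
  exact h.trans (by gcongr; exact dualNorm_le_mul_norm hρ hhi _)

theorem continuous_of_mul_seminorm_le_norm (hlo : ∀ X, ρlo * N X ≤ ‖X‖) (hρlo : 0 < ρlo) :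
    Continuous N := by
  refine (LipschitzWith.of_le_add_mul (Real.toNNReal ρlo⁻¹) fun G H => ?_).continuous
  have h := map_add_le_add N H (G - H)
  rw [add_sub_cancel] at h
  rw [Real.coe_toNNReal _ (by positivity), dist_eq_norm]
  refine h.trans ?_
  gcongr
  rw [le_inv_mul_iff₀ hρlo]
  exact hlo _

theorem seminorm_add_sq_le (s : ℝ) (hs : 0 < s) (x y : S) :
    N (x + y) ^ 2 ≤ (1 + s) * N x ^ 2 + (1 + s⁻¹) * N y ^ 2 := by
  have h := map_add_le_add N x y
  have h0 := apply_nonneg N (x + y)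
  have h1 : N (x + y) ^ 2 ≤ (N x + N y) ^ 2 := by gcongr
  have h2 : (1 + s) * N x ^ 2 + (1 + s⁻¹) * N y ^ 2 - (N x + N y) ^ 2
      = s⁻¹ * (s * N x - N y) ^ 2 := by
    field_simp
    ring
  have h3 : 0 ≤ s⁻¹ * (s * N x - N y) ^ 2 := by positivity
  linarith

theorem norm_add_sq_le_young (s : ℝ) (hs : 0 < s) (x y : S) :
    ‖x + y‖ ^ 2 ≤ (1 + s) * ‖x‖ ^ 2 + (1 + s⁻¹) * ‖y‖ ^ 2 :=
  seminorm_add_sq_le (N := normSeminorm ℝ S) s hs x y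

/-- Compare the minimizer with the feasible points X - tZ, N Z ≤ 1, and take the supremum over Z. A
zero radius is separate because the argument divides by t. -/
theorem inner_le_of_mem_lmo {X X' G : S} {t : ℝ} (ht : 0 ≤ t) (h : X' ∈ lmo N X t G) :
    inner ℝ G (X' - X) ≤ -(t * dualNorm N G) := by
  rcases ht.eq_or_lt with rfl | ht
  · have := h.2 X (by simp)
    rw [inner_sub_right]
    linarith
  have key : dualNorm N G ≤ t⁻¹ * inner ℝ G (X - X') := by
    refine dualNorm_le_of_forall fun Z hZ => ?_
    have h1 := h.2 (X - t • Z) (by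
      rw [sub_sub_cancel_left, map_neg_eq_map, map_smul_eq_mul, Real.norm_of_nonneg ht.le]
      nlinarith)
    rw [inner_sub_right, real_inner_smul_right] at h1
    rw [le_inv_mul_iff₀ ht, inner_sub_right]
    linarith
  rw [le_inv_mul_iff₀ ht] at key
  rw [inner_sub_right] at key ⊢
  linarith

variable [CompleteSpace S]

theorem IsSmooth.norm_gradient_sub_le (hρ : 0 < ρhi) (hlo : ∀ X, ρlo * N X ≤ ‖X‖)
    (hhi : ∀ X, ‖X‖ ≤ ρhi * N X) (hρlo : 0 < ρlo) {L : ℝ} {h : S → ℝ} (hs : IsSmooth N L h)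
    (X Y : S) : ‖gradient h X - gradient h Y‖ ≤ L / ρlo * N (X - Y) := by
  have h1 := (mul_norm_le_dualNorm hρ hlo hhi hρlo _).trans (hs.2 X Y)
  rw [div_mul_eq_mul_div, le_div_iff₀ hρlo]
  linarith

theorem IsSmooth.norm_gradient_sub_sq_le (hρ : 0 < ρhi) (hlo : ∀ X, ρlo * N X ≤ ‖X‖)
    (hhi : ∀ X, ‖X‖ ≤ ρhi * N X) (hρlo : 0 < ρlo) {L : ℝ} {h : S → ℝ} (hs : IsSmooth N L h)
    (X Y : S) : ‖gradient h X - gradient h Y‖ ^ 2 ≤ L ^ 2 / ρlo ^ 2 * N (X - Y) ^ 2 := by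
  have h1 := hs.norm_gradient_sub_le hρ hlo hhi hρlo X Y
  calc _ ≤ (L / ρlo * N (X - Y)) ^ 2 := by gcongr
    _ = _ := by ring

theorem IsSmooth.norm_gradient_sub_le_mul_norm (hρ : 0 < ρhi) (hlo : ∀ X, ρlo * N X ≤ ‖X‖)
    (hhi : ∀ X, ‖X‖ ≤ ρhi * N X) (hρlo : 0 < ρlo) {L : ℝ} (hL : 0 ≤ L) {h : S → ℝ}
    (hs : IsSmooth N L h) (X Y : S) :
    ‖gradient h X - gradient h Y‖ ≤ L / ρlo / ρlo * ‖X - Y‖ := by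
  refine (hs.norm_gradient_sub_le hρ hlo hhi hρlo X Y).trans ?_
  have h1 : N (X - Y) ≤ ‖X - Y‖ / ρlo := by
    rw [le_div_iff₀ hρlo]
    linarith [hlo (X - Y)]
  calc L / ρlo * N (X - Y) ≤ L / ρlo * (‖X - Y‖ / ρlo) := by gcongr
    _ = _ := by ring

theorem IsSmooth.continuous_gradient (hρ : 0 < ρhi) (hlo : ∀ X, ρlo * N X ≤ ‖X‖)
    (hhi : ∀ X, ‖X‖ ≤ ρhi * N X) (hρlo : 0 < ρlo) {L : ℝ} (hL : 0 ≤ L) {h : S → ℝ}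
    (hs : IsSmooth N L h) : Continuous (gradient h) := by
  refine (LipschitzWith.of_dist_le_mul (K := Real.toNNReal (L / ρlo / ρlo))
    fun X Y => ?_).continuous
  rw [Real.coe_toNNReal _ (by positivity), dist_eq_norm, dist_eq_norm]
  exact hs.norm_gradient_sub_le_mul_norm hρ hlo hhi hρlo hL X Y

/-- Along the segment from X to Y, subtracting the linear and quadratic terms leaves a function
whose derivative is nonpositive by smoothness and duality; comparing its endpoints gives the bound
without integrating the gradient. -/
theorem IsSmooth.le_quadratic (hρ : 0 < ρhi) (hhi : ∀ X, ‖X‖ ≤ ρhi * N X) {L : ℝ}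
    {h : S → ℝ} (hs : IsSmooth N L h) (X Y : S) :
    h Y ≤ h X + inner ℝ (gradient h X) (Y - X) + L / 2 * N (Y - X) ^ 2 := by
  set v := Y - X with hv
  let φ : ℝ → ℝ := fun t =>
    h (X + t • v) - t * inner ℝ (gradient h X) v - L / 2 * N v ^ 2 * t ^ 2
  have hφ : ∀ t, HasDerivAt φ
      (inner ℝ (gradient h (X + t • v)) v - inner ℝ (gradient h X) v - L * N v ^ 2 * t) t := by
    intro t
    have hg : HasDerivAt (fun t : ℝ => X + t • v) v t := by
      simpa using ((hasDerivAt_id t).smul_const v).const_add X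
    have h1 : HasDerivAt (fun t : ℝ => h (X + t • v)) (inner ℝ (gradient h (X + t • v)) v) t := by
      have := (hs.1 (X + t • v)).hasGradientAt.hasFDerivAt.comp_hasDerivAt t hg
      rwa [InnerProductSpace.toDual_apply_apply] at this
    have h2 := (h1.sub ((hasDerivAt_id t).mul_const (inner ℝ (gradient h X) v))).sub
      ((hasDerivAt_pow 2 t).const_mul (L / 2 * N v ^ 2))
    refine h2.congr_deriv ?_
    simp
    ring
  have hanti : AntitoneOn φ (Set.Icc 0 1) := by
    refine antitoneOn_of_deriv_nonpos (convex_Icc 0 1)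
      (fun t _ => (hφ t).continuousAt.continuousWithinAt)
      (fun t _ => (hφ t).differentiableAt.differentiableWithinAt) fun t ht => ?_
    rw [interior_Icc] at ht
    rw [(hφ t).deriv, ← inner_sub_left]
    have h1 := inner_le_dualNorm_mul hρ hhi (gradient h (X + t • v) - gradient h X) v
    have h2 := hs.2 (X + t • v) X
    rw [add_sub_cancel_left, map_smul_eq_mul, Real.norm_of_nonneg ht.1.le] at h2
    have h3 := mul_le_mul_of_nonneg_right h2 (apply_nonneg N v)
    nlinarith
  have := hanti (Set.left_mem_Icc.2 zero_le_one) (Set.right_mem_Icc.2 zero_le_one) zero_le_one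
  simp only [φ, one_smul, zero_smul, add_zero, hv, add_sub_cancel] at this
  linarith

theorem IsSmooth.lmo_step (hρ : 0 < ρhi) (hhi : ∀ X, ‖X‖ ≤ ρhi * N X) {L : ℝ} {h : S → ℝ}
    (hs : IsSmooth N L h) {γ : ℝ} (hγ : 0 < γ) {X X' G : S}
    (hX' : X' ∈ lmo N X (γ * dualNorm N G) G) :
    γ / 4 * dualNorm N (gradient h X) ^ 2 ≤ h X - h X'
      + 3 * γ / 2 * dualNorm N (gradient h X - G) ^ 2
      - (1 / (4 * γ) - L / 2) * N (X' - X) ^ 2 := by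
  have h1 := hs.le_quadratic hρ hhi X X'
  have hG := dualNorm_nonneg hρ hhi G
  have hE := dualNorm_nonneg hρ hhi (gradient h X - G)
  have h2 := inner_le_of_mem_lmo (mul_nonneg hγ.le hG) hX'
  have h3 := inner_le_dualNorm_mul hρ hhi (gradient h X - G) (X' - X)
  rw [inner_sub_left] at h3
  have h4 := hX'.1
  have h5 := dualNorm_add_le hρ hhi (gradient h X - G) G
  rw [sub_add_cancel] at h5
  have h6 := dualNorm_nonneg hρ hhi (gradient h X)
  have hd := apply_nonneg N (X' - X)
  generalize dualNorm N (gradient h X) = a at *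
  generalize dualNorm N (gradient h X - G) = e at *
  generalize dualNorm N G = b at *
  generalize N (X' - X) = d at *
  -- The decrease γb² is spent in two halves: one yields γa²/4 - γe²/2, the other d²/(2γ), since d ≤
  -- γb. The cross term e·d costs γe² and d²/(4γ), which produces the constants 3γ/2 and 1/(4γ).
  have h7 : a ^ 2 ≤ 2 * e ^ 2 + 2 * b ^ 2 := by nlinarith [sq_nonneg (e - b)]
  have h8 : d ^ 2 / γ ≤ γ * b ^ 2 := by
    rw [div_le_iff₀ hγ]
    nlinarith
  have h9 : e * d ≤ γ * e ^ 2 + d ^ 2 / γ / 4 := by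
    have : γ * e ^ 2 + d ^ 2 / γ / 4 - e * d = γ⁻¹ * (γ * e - d / 2) ^ 2 := by
      field_simp
      ring
    have : 0 ≤ γ⁻¹ * (γ * e - d / 2) ^ 2 := by positivity
    linarith
  have h10 : (1 / (4 * γ) - L / 2) * d ^ 2 = d ^ 2 / γ / 4 - L / 2 * d ^ 2 := by
    field_simp
  have h11 := mul_le_mul_of_nonneg_left h7 hγ.le
  rw [h10]
  nlinarith

theorem gradient_objective {n : ℕ} {f : Fin n → S → ℝ} (hf : ∀ j, Differentiable ℝ (f j))
    (X : S) : gradient (objective f) X = (n : ℝ)⁻¹ • ∑ j, gradient (f j) X := by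
  refine HasGradientAt.gradient ?_
  rw [hasGradientAt_iff_hasFDerivAt]
  have h1 : HasFDerivAt (fun Y => ∑ j, f j Y)
      (∑ j, InnerProductSpace.toDual ℝ S (gradient (f j) X)) X :=
    HasFDerivAt.fun_sum fun j _ => (hf j X).hasGradientAt.hasFDerivAt
  have h2 := h1.const_mul (n : ℝ)⁻¹
  simp only [map_smulₛₗ, map_sum]
  exact h2

end NormGeometry

end EF21Muon

/-! ### Independence: compressors and oracles at random inputs. -/

namespace EF21Muon

section Independence

variable {Ω E F : Type*} {m : MeasurableSpace Ω} [mΩ : MeasurableSpace Ω] [MeasurableSpace E] [MeasurableSpace F]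
  {μ : Measure Ω} [IsProbabilityMeasure μ] {ν : Measure F}
  {Y : Ω → E} {Z : Ω → F}

theorem map_prodMk_eq_prod_of_indep (hm : m ≤ mΩ) (hY : Measurable[m] Y)
    (hZ : MeasurePreserving Z μ ν) (hind : Indep m (MeasurableSpace.comap Z inferInstance) μ) :
    μ.map (fun ω => (Y ω, Z ω)) = (μ.map Y).prod ν := by
  have hi : IndepFun Y Z μ :=
    (IndepFun_iff_Indep Y Z μ).2 (indep_of_indep_of_le_left hind hY.comap_le)
  rw [(indepFun_iff_map_prod_eq_prod_map_map (hY.mono hm le_rfl).aemeasurable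
    hZ.measurable.aemeasurable).1 hi, hZ.map_eq]

theorem isProbabilityMeasure_of_measurePreserving (hZ : MeasurePreserving Z μ ν) :
    IsProbabilityMeasure ν := by
  rw [← hZ.map_eq]
  exact Measure.isProbabilityMeasure_map hZ.measurable.aemeasurable

/-- Independence makes the joint law a product, so Tonelli allows the input to be frozen. Working
with `lintegral` requires no prior integrability; the bound itself later supplies it. -/
theorem lintegral_le_of_indep (hm : m ≤ mΩ) (hY : Measurable[m] Y)
    (hZ : MeasurePreserving Z μ ν) (hind : Indep m (MeasurableSpace.comap Z inferInstance) μ)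
    {φ : E × F → ENNReal} (hφ : Measurable φ) {ψ : E → ENNReal} (hψ : Measurable ψ)
    (h : ∀ y, ∫⁻ z, φ (y, z) ∂ν ≤ ψ y) :
    ∫⁻ ω, φ (Y ω, Z ω) ∂μ ≤ ∫⁻ ω, ψ (Y ω) ∂μ := by
  have hY' := hY.mono hm le_rfl
  have := isProbabilityMeasure_of_measurePreserving hZ
  rw [← lintegral_map hφ (hY'.prodMk hZ.measurable), map_prodMk_eq_prod_of_indep hm hY hZ hind,
    lintegral_prod _ hφ.aemeasurable, ← lintegral_map hψ hY']
  exact lintegral_mono h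

end Independence

section RealBounds

variable {Ω : Type*} [MeasurableSpace Ω] {μ : Measure Ω}

theorem integrable_and_integral_le_of_lintegral_le {q : Ω → ℝ} (hq : AEStronglyMeasurable q μ)
    (h0 : ∀ ω, 0 ≤ q ω) {c : ℝ} (hc : 0 ≤ c)
    (h : ∫⁻ ω, ENNReal.ofReal (q ω) ∂μ ≤ ENNReal.ofReal c) :
    Integrable q μ ∧ ∫ ω, q ω ∂μ ≤ c := by
  refine ⟨⟨hq, ?_⟩, ?_⟩
  · rw [hasFiniteIntegral_iff_ofReal (Filter.Eventually.of_forall h0)]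
    exact h.trans_lt ENNReal.ofReal_lt_top
  · rw [integral_eq_lintegral_of_nonneg_ae (Filter.Eventually.of_forall h0) hq]
    exact ENNReal.toReal_le_of_le_ofReal hc h

theorem integrable_inner_of_memLp_two {S : Type*} [NormedAddCommGroup S] [InnerProductSpace ℝ S]
    {Y Z : Ω → S} (hY : MemLp Y 2 μ) (hZ : MemLp Z 2 μ) :
    Integrable (fun ω => inner ℝ (Y ω) (Z ω)) μ :=
  (hY.norm.integrable_mul hZ.norm).mono' (hY.1.inner hZ.1)
    (Filter.Eventually.of_forall fun ω => norm_inner_le_norm (Y ω) (Z ω))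

end RealBounds

section Oracles

variable {Ω : Type*} {m : MeasurableSpace Ω} [mΩ : MeasurableSpace Ω] {μ : Measure Ω}
  [IsProbabilityMeasure μ] {S : Type*} [NormedAddCommGroup S] [InnerProductSpace ℝ S] [FiniteDimensional ℝ S]
  [MeasurableSpace S] [BorelSpace S] {N : Seminorm ℝ S} {ρlo ρhi : ℝ}

omit [IsProbabilityMeasure μ] [FiniteDimensional ℝ S] [MeasurableSpace S] [BorelSpace S] in
theorem integrable_seminorm_sq (hlo : ∀ X, ρlo * N X ≤ ‖X‖) (hρlo : 0 < ρlo) {Y : Ω → S}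
    (hY : MemLp Y 2 μ) : Integrable (fun ω => N (Y ω) ^ 2) μ := by
  have hc := continuous_of_mul_seminorm_le_norm hlo hρlo
  refine (hY.norm.integrable_sq.const_mul (1 / ρlo ^ 2)).mono'
    ((hc.comp_aestronglyMeasurable hY.1).pow 2) (Filter.Eventually.of_forall fun ω => ?_)
  rw [Real.norm_of_nonneg (by positivity), one_div, le_inv_mul_iff₀ (by positivity), ← mul_pow]
  have := hlo (Y ω)
  gcongr

theorem IsCompressor.memLp_and_integral_le {U : Type*} [MeasurableSpace U] {ν : Measure U}
    {C : S → U → S} {α : ℝ} (hα : α ≤ 1) (hC : IsCompressor N α ν C)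
    (hlo : ∀ X, ρlo * N X ≤ ‖X‖) (hρlo : 0 < ρlo) (hhi : ∀ X, ‖X‖ ≤ ρhi * N X)
    (hm : m ≤ mΩ) {Y : Ω → S} (hY : Measurable[m] Y)
    (hYL : MemLp Y 2 μ) {Z : Ω → U} (hZ : MeasurePreserving Z μ ν)
    (hind : Indep m (MeasurableSpace.comap Z inferInstance) μ) :
    MemLp (fun ω => C (Y ω) (Z ω) - Y ω) 2 μ ∧
      ∫ ω, N (C (Y ω) (Z ω) - Y ω) ^ 2 ∂μ ≤ (1 - α) * ∫ ω, N (Y ω) ^ 2 ∂μ := by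
  have hN := (continuous_of_mul_seminorm_le_norm hlo hρlo).measurable
  have hY' := hY.mono hm le_rfl
  have hmeas : Measurable fun ω => C (Y ω) (Z ω) - Y ω :=
    (hC.1.comp (hY'.prodMk hZ.measurable)).sub hY'
  have hint := (integrable_seminorm_sq hlo hρlo hYL).const_mul (1 - α)
  have h0 : ∀ X : S, 0 ≤ (1 - α) * N X ^ 2 :=
    fun X => mul_nonneg (by linarith) (by positivity)
  have h1 := lintegral_le_of_indep hm hY hZ hind
    (φ := fun p => ENNReal.ofReal (N (C p.1 p.2 - p.1) ^ 2))
    ((hN.comp (hC.1.sub measurable_fst)).pow_const 2).ennreal_ofReal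
    (ψ := fun y => ENNReal.ofReal ((1 - α) * N y ^ 2))
    ((hN.pow_const 2).const_mul _).ennreal_ofReal hC.2
  rw [← ofReal_integral_eq_lintegral_ofReal hint (Filter.Eventually.of_forall fun ω => h0 _)] at h1
  have h2 := integrable_and_integral_le_of_lintegral_le
    ((hN.comp hmeas).pow_const 2).aestronglyMeasurable (fun ω => by positivity)
    (integral_nonneg fun ω => h0 (Y ω)) h1
  refine ⟨?_, by rw [← integral_const_mul]; exact h2.2⟩
  rw [memLp_two_iff_integrable_sq_norm hmeas.aestronglyMeasurable]
  refine (h2.1.const_mul (ρhi ^ 2)).mono' (hmeas.norm.pow_const 2).aestronglyMeasurable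
    (Filter.Eventually.of_forall fun ω => ?_)
  rw [Real.norm_of_nonneg (by positivity), ← mul_pow]
  exact pow_le_pow_left₀ (norm_nonneg _) (hhi (C (Y ω) (Z ω) - Y ω)) 2

variable [CompleteSpace S] {Ξ : Type*} [MeasurableSpace Ξ] {D : Measure Ξ} {σ : ℝ} {h : S → ℝ}
  {g : S → Ξ → S} {W : Ω → S} {Z : Ω → Ξ}

theorem IsOracle.noise_memLp_and_integral_le (hg : IsOracle σ D h g)
    (hh : Measurable (gradient h)) (hm : m ≤ mΩ) (hW : Measurable[m] W)
    (hZ : MeasurePreserving Z μ D) (hind : Indep m (MeasurableSpace.comap Z inferInstance) μ) :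
    MemLp (fun ω => g (W ω) (Z ω) - gradient h (W ω)) 2 μ ∧
      ∫ ω, ‖g (W ω) (Z ω) - gradient h (W ω)‖ ^ 2 ∂μ ≤ σ ^ 2 := by
  have hW' := hW.mono hm le_rfl
  have hmeas : Measurable fun ω => g (W ω) (Z ω) - gradient h (W ω) :=
    (hg.1.comp (hW'.prodMk hZ.measurable)).sub (hh.comp hW')
  have h1 := lintegral_le_of_indep hm hW hZ hind
    (φ := fun p => ENNReal.ofReal (‖g p.1 p.2 - gradient h p.1‖ ^ 2))
    (((hg.1.sub (hh.comp measurable_fst)).norm).pow_const 2).ennreal_ofReal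
    (ψ := fun _ => ENNReal.ofReal (σ ^ 2)) measurable_const fun y => (hg.2 y).2.2
  rw [lintegral_const, measure_univ, mul_one] at h1
  have h2 := integrable_and_integral_le_of_lintegral_le
    (hmeas.norm.pow_const 2).aestronglyMeasurable (fun ω => by positivity) (sq_nonneg σ) h1
  exact ⟨(memLp_two_iff_integrable_sq_norm hmeas.aestronglyMeasurable).2 h2.1, h2.2⟩

/-- Given the past, Y and W are fixed and the noise has mean zero, so the inner Fubini integral
vanishes. Square integrability of both factors justifies Fubini. -/
theorem IsOracle.integral_inner_noise_eq_zero (hg : IsOracle σ D h g)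
    (hh : Measurable (gradient h)) (hm : m ≤ mΩ) (hW : Measurable[m] W)
    {Y : Ω → S} (hY : Measurable[m] Y) (hYL : MemLp Y 2 μ)
    (hZ : MeasurePreserving Z μ D) (hind : Indep m (MeasurableSpace.comap Z inferInstance) μ) :
    ∫ ω, inner ℝ (Y ω) (g (W ω) (Z ω) - gradient h (W ω)) ∂μ = 0 := by
  have := isProbabilityMeasure_of_measurePreserving hZ
  have hYW : Measurable[m] fun ω => (Y ω, W ω) := hY.prodMk hW
  have hYW' : Measurable fun ω => ((Y ω, W ω), Z ω) :=
    (hYW.mono hm le_rfl).prodMk hZ.measurable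
  have hnoise := (hg.noise_memLp_and_integral_le hh hm hW hZ hind).1
  have hint : Integrable (fun ω => inner ℝ (Y ω) (g (W ω) (Z ω) - gradient h (W ω))) μ :=
    integrable_inner_of_memLp_two hYL hnoise
  let φ : (S × S) × Ξ → ℝ := fun p => inner ℝ p.1.1 (g p.1.2 p.2 - gradient h p.1.2)
  have hφ : Measurable φ := by
    have h1 : Measurable fun p : (S × S) × Ξ => g p.1.2 p.2 :=
      hg.1.comp ((measurable_snd.comp measurable_fst).prodMk measurable_snd)
    have h2 : Measurable fun p : (S × S) × Ξ => gradient h p.1.2 :=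
      hh.comp (measurable_snd.comp measurable_fst)
    exact (measurable_fst.comp measurable_fst).inner (h1.sub h2)
  have hφi : Integrable φ (μ.map fun ω => ((Y ω, W ω), Z ω)) :=
    (integrable_map_measure hφ.aestronglyMeasurable hYW'.aemeasurable).2 hint
  have hprod := map_prodMk_eq_prod_of_indep hm hYW hZ hind
  calc ∫ ω, inner ℝ (Y ω) (g (W ω) (Z ω) - gradient h (W ω)) ∂μ
      = ∫ p, φ p ∂(μ.map fun ω => ((Y ω, W ω), Z ω)) :=
        (integral_map hYW'.aemeasurable hφ.aestronglyMeasurable).symm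
    _ = ∫ y, ∫ z, φ (y, z) ∂D ∂(μ.map fun ω => (Y ω, W ω)) := by
        rw [hprod] at hφi ⊢
        exact integral_prod _ hφi
    _ = 0 := by
        refine integral_eq_zero_of_ae (Filter.Eventually.of_forall fun y => ?_)
        have h1 := hg.2 y.2
        have h2 : Integrable (fun z => g y.2 z - gradient h y.2) D :=
          h1.1.sub (integrable_const _)
        change ∫ z, inner ℝ y.1 (g y.2 z - gradient h y.2) ∂D = 0
        rw [integral_inner h2, integral_sub h1.1 (integrable_const _), h1.2.1]
        simp

/-- Pythagoras: the cross term has zero mean, so fresh noise adds its variance with no Young factor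
on Y. -/
theorem IsOracle.integral_norm_add_smul_noise_sq_le (hg : IsOracle σ D h g)
    (hh : Measurable (gradient h)) (hm : m ≤ mΩ) (hW : Measurable[m] W)
    {Y : Ω → S} (hY : Measurable[m] Y) (hYL : MemLp Y 2 μ)
    (hZ : MeasurePreserving Z μ D) (hind : Indep m (MeasurableSpace.comap Z inferInstance) μ)
    (c : ℝ) :
    ∫ ω, ‖Y ω + c • (g (W ω) (Z ω) - gradient h (W ω))‖ ^ 2 ∂μ
      ≤ ∫ ω, ‖Y ω‖ ^ 2 ∂μ + c ^ 2 * σ ^ 2 := by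
  obtain ⟨h1, h2⟩ := hg.noise_memLp_and_integral_le hh hm hW hZ hind
  have h3 := hg.integral_inner_noise_eq_zero hh hm hW hY hYL hZ hind
  have h4 := integrable_inner_of_memLp_two hYL h1
  have h5 := hYL.norm.integrable_sq
  have h6 := h1.norm.integrable_sq
  have h7 : ∀ ω, ‖Y ω + c • (g (W ω) (Z ω) - gradient h (W ω))‖ ^ 2 =
      ‖Y ω‖ ^ 2 + 2 * c * inner ℝ (Y ω) (g (W ω) (Z ω) - gradient h (W ω))
        + c ^ 2 * ‖g (W ω) (Z ω) - gradient h (W ω)‖ ^ 2 := by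
    intro ω
    rw [norm_add_sq_real, real_inner_smul_right, norm_smul, mul_pow, Real.norm_eq_abs, sq_abs]
    ring
  simp_rw [h7]
  have h8 : Integrable (fun ω => ‖Y ω‖ ^ 2
      + 2 * c * inner ℝ (Y ω) (g (W ω) (Z ω) - gradient h (W ω))) μ := h5.add (h4.const_mul _)
  rw [integral_add h8 (h6.const_mul _), integral_add h5 (h4.const_mul _),
    integral_const_mul, integral_const_mul, h3]
  nlinarith [mul_le_mul_of_nonneg_left h2 (sq_nonneg c)]

end Oracles

end EF21Muon

/-! ### Bookkeeping of the independent sources of randomness. -/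

namespace EF21Muon

section Sources

variable {Ω : Type*} {n : ℕ} {Ξ : Fin n → Type*} {U V : ℕ → Type*}
  [∀ j, MeasurableSpace (Ξ j)] [∀ k, MeasurableSpace (U k)] [∀ k, MeasurableSpace (V k)]

/-- The σ-algebras generated by the single sources of randomness. -/
@[reducible] def source (ξ : ℕ → ∀ j, Ω → Ξ j) (η : ∀ k, Ω → U k) (θ : ∀ k, Ω → V k) :
    (ℕ × Fin n) ⊕ ℕ ⊕ ℕ → MeasurableSpace Ω :=
  Sum.elim (fun p : ℕ × Fin n => MeasurableSpace.comap (ξ p.1 p.2) inferInstance)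
    (Sum.elim (fun k : ℕ => MeasurableSpace.comap (η k) inferInstance)
      (fun k : ℕ => MeasurableSpace.comap (θ k) inferInstance))

/-- The σ-algebra generated by the sources in `T`. -/
@[reducible] def known (ξ : ℕ → ∀ j, Ω → Ξ j) (η : ∀ k, Ω → U k) (θ : ∀ k, Ω → V k)
    (T : Set ((ℕ × Fin n) ⊕ ℕ ⊕ ℕ)) : MeasurableSpace Ω :=
  ⨆ i ∈ T, source ξ η θ i

/-- The samples of the iterations before `a`, the server seeds before `b` and the worker seeds
before `c`. -/
def upTo (n a b c : ℕ) : Set ((ℕ × Fin n) ⊕ ℕ ⊕ ℕ) :=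
  {i | Sum.elim (fun p => p.1 < a) (Sum.elim (fun k => k < b) (fun k => k < c)) i}

theorem upTo_mono {a b c a' b' c' : ℕ} (ha : a ≤ a') (hb : b ≤ b') (hc : c ≤ c') :
    upTo n a b c ⊆ upTo n a' b' c' := by
  rintro (p | k | k) h
  · exact lt_of_lt_of_le (b := a) h ha
  · exact lt_of_lt_of_le (b := b) h hb
  · exact lt_of_lt_of_le (b := c) h hc

variable (ξ : ℕ → ∀ j, Ω → Ξ j) (η : ∀ k, Ω → U k) (θ : ∀ k, Ω → V k)

theorem known_mono {T T' : Set ((ℕ × Fin n) ⊕ ℕ ⊕ ℕ)} (h : T ⊆ T') :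
    known ξ η θ T ≤ known ξ η θ T' :=
  biSup_mono h

theorem source_le_known {T : Set ((ℕ × Fin n) ⊕ ℕ ⊕ ℕ)} {i : (ℕ × Fin n) ⊕ ℕ ⊕ ℕ} (h : i ∈ T) :
    source ξ η θ i ≤ known ξ η θ T :=
  le_biSup (source ξ η θ) h

theorem measurable_sample {T : Set ((ℕ × Fin n) ⊕ ℕ ⊕ ℕ)} {k : ℕ} {j : Fin n}
    (h : Sum.inl (k, j) ∈ T) : Measurable[known ξ η θ T] (ξ k j) :=
  measurable_iff_comap_le.2 (source_le_known ξ η θ h)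

theorem measurable_server {T : Set ((ℕ × Fin n) ⊕ ℕ ⊕ ℕ)} {k : ℕ}
    (h : Sum.inr (Sum.inl k) ∈ T) : Measurable[known ξ η θ T] (η k) :=
  measurable_iff_comap_le.2 (source_le_known ξ η θ h)

theorem measurable_worker {T : Set ((ℕ × Fin n) ⊕ ℕ ⊕ ℕ)} {k : ℕ}
    (h : Sum.inr (Sum.inr k) ∈ T) : Measurable[known ξ η θ T] (θ k) :=
  measurable_iff_comap_le.2 (source_le_known ξ η θ h)

theorem past_le_known (k : ℕ) : past ξ η θ k ≤ known ξ η θ (upTo n (k + 1) k k) := by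
  refine sup_le (iSup₂_le fun i hi => iSup_le fun j => ?_)
    (sup_le (iSup₂_le fun i hi => ?_) (iSup₂_le fun i hi => ?_))
  · exact source_le_known ξ η θ (i := Sum.inl (i, j)) (Nat.lt_succ_of_le hi)
  · exact source_le_known ξ η θ (i := Sum.inr (Sum.inl i)) hi
  · exact source_le_known ξ η θ (i := Sum.inr (Sum.inr i)) hi

variable {ξ η θ} [mΩ : MeasurableSpace Ω] {μ : Measure Ω} {D : ∀ j, Measure (Ξ j)}
  {νU : ∀ k, Measure (U k)} {νV : ∀ k, Measure (V k)}

theorem IsRandomness.source_le (h : IsRandomness μ D νU νV ξ η θ) (i : (ℕ × Fin n) ⊕ ℕ ⊕ ℕ) :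
    source ξ η θ i ≤ mΩ := by
  rcases i with p | k | k
  · exact (h.sample_law p.1 p.2).measurable.comap_le
  · exact (h.server_law k).measurable.comap_le
  · exact (h.worker_law k).measurable.comap_le

theorem IsRandomness.known_le (h : IsRandomness μ D νU νV ξ η θ)
    (T : Set ((ℕ × Fin n) ⊕ ℕ ⊕ ℕ)) : known ξ η θ T ≤ mΩ :=
  iSup₂_le fun i _ => h.source_le i

theorem IsRandomness.indep_known_source (h : IsRandomness μ D νU νV ξ η θ)
    {T : Set ((ℕ × Fin n) ⊕ ℕ ⊕ ℕ)} {i : (ℕ × Fin n) ⊕ ℕ ⊕ ℕ} (hi : i ∉ T) :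
    Indep (known ξ η θ T) (source ξ η θ i) μ := by
  have := indep_iSup_of_disjoint h.source_le h.indep (Set.disjoint_singleton_right.2 hi)
  simpa only [Set.mem_singleton_iff, iSup_iSup_eq_left] using this

variable [IsProbabilityMeasure μ] {S : Type*} [NormedAddCommGroup S] [InnerProductSpace ℝ S]
  [FiniteDimensional ℝ S] [CompleteSpace S] [MeasurableSpace S] [BorelSpace S]

/-- Add the workers one at a time, applying Pythagoras at each insertion. With c proportional to
1/n, the n variances sum to order σ²/n. -/
theorem IsRandomness.integral_norm_add_sum_noise_sq_le (h : IsRandomness μ D νU νV ξ η θ)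
    {f : Fin n → S → ℝ} {σ : ℝ} {g : ∀ j, S → Ξ j → S} (hg : ∀ j, IsOracle σ (D j) (f j) (g j))
    (hf : ∀ j, Measurable (gradient (f j))) {T : Set ((ℕ × Fin n) ⊕ ℕ ⊕ ℕ)} {k : ℕ}
    (hT : ∀ j, Sum.inl (k, j) ∉ T) {Y W : Ω → S} (hY : Measurable[known ξ η θ T] Y)
    (hW : Measurable[known ξ η θ T] W) (hYL : MemLp Y 2 μ) (c : ℝ) :
    ∫ ω, ‖Y ω + c • ∑ j, (g j (W ω) (ξ k j ω) - gradient (f j) (W ω))‖ ^ 2 ∂μ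
      ≤ ∫ ω, ‖Y ω‖ ^ 2 ∂μ + n * (c ^ 2 * σ ^ 2) := by
  suffices H : ∀ s : Finset (Fin n),
      Measurable[known ξ η θ (T ∪ {i | ∃ j ∈ s, i = Sum.inl (k, j)})] (fun ω =>
        Y ω + c • ∑ j ∈ s, (g j (W ω) (ξ k j ω) - gradient (f j) (W ω))) ∧
      MemLp (fun ω => Y ω + c • ∑ j ∈ s, (g j (W ω) (ξ k j ω) - gradient (f j) (W ω))) 2 μ ∧
      ∫ ω, ‖Y ω + c • ∑ j ∈ s, (g j (W ω) (ξ k j ω) - gradient (f j) (W ω))‖ ^ 2 ∂μ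
        ≤ ∫ ω, ‖Y ω‖ ^ 2 ∂μ + s.card * (c ^ 2 * σ ^ 2) by
    simpa using (H Finset.univ).2.2
  intro s
  induction s using Finset.induction_on with
  | empty =>
    simp only [Finset.sum_empty, smul_zero, add_zero, Finset.card_empty, Nat.cast_zero, zero_mul]
    exact ⟨hY.mono (known_mono ξ η θ Set.subset_union_left) le_rfl, hYL, le_rfl⟩
  | insert j s hj ih =>
    obtain ⟨h1, h2, h3⟩ := ih
    have heq : ∀ ω, Y ω + c • ∑ i ∈ insert j s, (g i (W ω) (ξ k i ω) - gradient (f i) (W ω)) =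
        (Y ω + c • ∑ i ∈ s, (g i (W ω) (ξ k i ω) - gradient (f i) (W ω)))
          + c • (g j (W ω) (ξ k j ω) - gradient (f j) (W ω)) := by
      intro ω
      rw [Finset.sum_insert hj, smul_add]
      abel
    -- The noise already added belongs to the known information; sample j is still fresh because j ∉
    -- s.
    have hnot : Sum.inl (k, j) ∉ T ∪ {i | ∃ j ∈ s, i = Sum.inl (k, j)} := by
      rintro (h' | ⟨j', hj', h'⟩)
      · exact hT j h'
      · cases h'
        exact hj hj'
    have hW' := hW.mono (known_mono ξ η θ
      (Set.subset_union_left (t := {i | ∃ j ∈ s, i = Sum.inl (k, j)}))) le_rfl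
    have hsub : T ∪ {i | ∃ j ∈ s, i = Sum.inl (k, j)} ⊆
        T ∪ {i | ∃ j' ∈ insert j s, i = Sum.inl (k, j')} := by
      refine Set.union_subset_union_right _ ?_
      rintro i ⟨j', hj', rfl⟩
      exact ⟨j', Finset.mem_insert_of_mem hj', rfl⟩
    have hind := h.indep_known_source hnot
    have hle := h.known_le (T ∪ {i | ∃ j ∈ s, i = Sum.inl (k, j)})
    simp_rw [heq]
    refine ⟨?_, ?_, ?_⟩
    · have hWs := hW'.mono (known_mono ξ η θ hsub) le_rfl
      have hξ : Measurable[known ξ η θ (T ∪ {i | ∃ j' ∈ insert j s, i = Sum.inl (k, j')})]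
          (ξ k j) :=
        measurable_sample ξ η θ (Or.inr ⟨j, Finset.mem_insert_self _ _, rfl⟩)
      exact (h1.mono (known_mono ξ η θ hsub) le_rfl).add
        ((((hg j).1.comp (hWs.prodMk hξ)).sub ((hf j).comp hWs)).const_smul c)
    · exact h2.add (((hg j).noise_memLp_and_integral_le (hf j) hle hW' (h.sample_law k j)
        hind).1.const_smul c)
    · have h4 := (hg j).integral_norm_add_smul_noise_sq_le (hf j) hle hW' h1 h2
        (h.sample_law k j) hind c
      rw [Finset.card_insert_of_notMem hj]
      push_cast
      linarith

end Sources

end EF21Muon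

/-! ### Measurability and square integrability of the iterates. -/

namespace EF21Muon

/-- A run of EF21-Muon under the standing assumptions on the norm, the objective, the oracles, the
compressors and the parameters. -/
structure Setting {S : Type*} [NormedAddCommGroup S] [InnerProductSpace ℝ S] [CompleteSpace S]
    [MeasurableSpace S] {Ω : Type*} [MeasurableSpace Ω] (μ : Measure Ω)
    {n : ℕ} {Ξ : Fin n → Type*} [∀ j, MeasurableSpace (Ξ j)]
    {U V : ℕ → Type*} [∀ k, MeasurableSpace (U k)] [∀ k, MeasurableSpace (V k)]
    (D : ∀ j, Measure (Ξ j)) (νU : ∀ k, Measure (U k)) (νV : ∀ k, Measure (V k))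
    (ξ : ℕ → ∀ j, Ω → Ξ j) (η : ∀ k, Ω → U k) (θ : ∀ k, Ω → V k)
    (N : Seminorm ℝ S) (ρlo ρhi : ℝ) (f : Fin n → S → ℝ) (L : ℝ) (Lj : Fin n → ℝ) (σ : ℝ)
    (g : ∀ j, S → Ξ j → S) (αP αD : ℝ) (C : ∀ k, S → U k → S) (Cw : ∀ k, Fin n → S → V k → S)
    (β γ : ℝ) (X₀ : S) (X W : ℕ → Ω → S) (M G : ℕ → Fin n → Ω → S) : Prop where
  rand : IsRandomness μ D νU νV ξ η θ
  one_le : 1 ≤ n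
  ρlo_pos : 0 < ρlo
  ρhi_pos : 0 < ρhi
  lo : ∀ X : S, ρlo * N X ≤ ‖X‖
  hi : ∀ X : S, ‖X‖ ≤ ρhi * N X
  L_nonneg : 0 ≤ L
  smooth : IsSmooth N L (objective f)
  Lj_nonneg : ∀ j, 0 ≤ Lj j
  smoothj : ∀ j, IsSmooth N (Lj j) (f j)
  oracle : ∀ j, IsOracle σ (D j) (f j) (g j)
  αP_pos : 0 < αP
  αP_le : αP ≤ 1
  αD_pos : 0 < αD
  αD_le : αD ≤ 1
  comp : ∀ k, IsCompressor N αP (νU k) (C k)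
  compw : ∀ k j, IsCompressor (normSeminorm ℝ S) αD (νV k) (Cw k j)
  β_pos : 0 < β
  β_le : β ≤ 1
  γ_pos : 0 < γ
  run : IsRun N β γ X₀ g C Cw ξ η θ X W M G

theorem memLp_of_memLp_sub {Ω S : Type*} [MeasurableSpace Ω] {μ : Measure Ω}
    [NormedAddCommGroup S] {p : ENNReal} {A B : Ω → S} (h : MemLp (fun ω => A ω - B ω) p μ)
    (hB : MemLp B p μ) : MemLp A p μ := by
  have h1 := h.add hB
  rwa [show (fun ω => A ω - B ω) + B = A from sub_add_cancel A B] at h1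

section Run

variable {S : Type*} [NormedAddCommGroup S] [InnerProductSpace ℝ S] [FiniteDimensional ℝ S]
  [CompleteSpace S] [MeasurableSpace S] [BorelSpace S]
  {Ω : Type*} [mΩ : MeasurableSpace Ω] {μ : Measure Ω} [IsProbabilityMeasure μ]
  {n : ℕ} {Ξ : Fin n → Type*} [∀ j, MeasurableSpace (Ξ j)]
  {U V : ℕ → Type*} [∀ k, MeasurableSpace (U k)] [∀ k, MeasurableSpace (V k)]
  {D : ∀ j, Measure (Ξ j)} {νU : ∀ k, Measure (U k)} {νV : ∀ k, Measure (V k)}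
  {ξ : ℕ → ∀ j, Ω → Ξ j} {η : ∀ k, Ω → U k} {θ : ∀ k, Ω → V k}
  {N : Seminorm ℝ S} {ρlo ρhi : ℝ} {f : Fin n → S → ℝ} {L : ℝ} {Lj : Fin n → ℝ} {σ : ℝ}
  {g : ∀ j, S → Ξ j → S} {αP αD : ℝ} {C : ∀ k, S → U k → S} {Cw : ∀ k, Fin n → S → V k → S}
  {β γ : ℝ} {X₀ : S} {X W : ℕ → Ω → S} {M G : ℕ → Fin n → Ω → S}

namespace Setting

omit [FiniteDimensional ℝ S] [IsProbabilityMeasure μ] in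
theorem measurable_gradient
    (h : Setting μ D νU νV ξ η θ N ρlo ρhi f L Lj σ g αP αD C Cw β γ X₀ X W M G) (j : Fin n) :
    Measurable (gradient (f j)) :=
  ((h.smoothj j).continuous_gradient h.ρhi_pos h.lo h.hi h.ρlo_pos (h.Lj_nonneg j)).measurable

omit [IsProbabilityMeasure μ] in
-- The order within an iteration is tracked exactly: X^{k+1} uses no new source, W^{k+1} adds the
-- server seed, M^{k+1} adds the samples. Hence each seed or sample is independent of the quantity
-- it acts on.
theorem measurable_iterates
    (h : Setting μ D νU νV ξ η θ N ρlo ρhi f L Lj σ g αP αD C Cw β γ X₀ X W M G) (k : ℕ) :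
    Measurable[known ξ η θ (upTo n (k + 1) k k)] (X k) ∧
      Measurable[known ξ η θ (upTo n (k + 1) k k)] (W k) ∧
      (∀ j, Measurable[known ξ η θ (upTo n (k + 1) k k)] (M k j)) ∧
      (∀ j, Measurable[known ξ η θ (upTo n (k + 1) k k)] (G k j)) ∧
      Measurable[known ξ η θ (upTo n (k + 1) k k)] (X (k + 1)) ∧
      Measurable[known ξ η θ (upTo n (k + 1) (k + 1) k)] (W (k + 1)) ∧
      ∀ j, Measurable[known ξ η θ (upTo n (k + 2) (k + 1) k)] (M (k + 1) j) := by
  have step : ∀ k, Measurable[known ξ η θ (upTo n (k + 1) k k)] (X k) ∧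
      Measurable[known ξ η θ (upTo n (k + 1) k k)] (W k) ∧
      (∀ j, Measurable[known ξ η θ (upTo n (k + 1) k k)] (M k j)) ∧
      (∀ j, Measurable[known ξ η θ (upTo n (k + 1) k k)] (G k j)) →
      Measurable[known ξ η θ (upTo n (k + 1) k k)] (X (k + 1)) ∧
      Measurable[known ξ η θ (upTo n (k + 1) (k + 1) k)] (W (k + 1)) ∧
      (∀ j, Measurable[known ξ η θ (upTo n (k + 2) (k + 1) k)] (M (k + 1) j)) ∧
      ∀ j, Measurable[known ξ η θ (upTo n (k + 2) (k + 1) (k + 1))] (G (k + 1) j) := by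
    rintro k ⟨-, hW, hM, hG⟩
    have hX := (h.run.X_meas k).mono (past_le_known ξ η θ k) le_rfl
    have l1 : known ξ η θ (upTo n (k + 1) k k) ≤ known ξ η θ (upTo n (k + 1) (k + 1) k) :=
      known_mono ξ η θ (upTo_mono le_rfl (by omega) le_rfl)
    have l2 : known ξ η θ (upTo n (k + 1) (k + 1) k) ≤ known ξ η θ (upTo n (k + 2) (k + 1) k) :=
      known_mono ξ η θ (upTo_mono (by omega) le_rfl le_rfl)
    have l3 : known ξ η θ (upTo n (k + 2) (k + 1) k) ≤
        known ξ η θ (upTo n (k + 2) (k + 1) (k + 1)) :=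
      known_mono ξ η θ (upTo_mono le_rfl le_rfl (by omega))
    have hW' : Measurable[known ξ η θ (upTo n (k + 1) (k + 1) k)] (W (k + 1)) := by
      rw [funext (h.run.W_succ k)]
      have hWl := hW.mono l1 le_rfl
      have hη : Measurable[known ξ η θ (upTo n (k + 1) (k + 1) k)] (η k) :=
        measurable_server ξ η θ (Nat.lt_succ_self k)
      exact hWl.add ((h.comp k).1.comp (((hX.mono l1 le_rfl).sub hWl).prodMk hη))
    have hM' : ∀ j, Measurable[known ξ η θ (upTo n (k + 2) (k + 1) k)] (M (k + 1) j) := by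
      intro j
      rw [funext (h.run.M_succ k j)]
      have hξ : Measurable[known ξ η θ (upTo n (k + 2) (k + 1) k)] (ξ (k + 1) j) :=
        measurable_sample ξ η θ (Nat.lt_succ_self (k + 1))
      exact (((hM j).mono (l1.trans l2) le_rfl).const_smul _).add
        (((h.oracle j).1.comp ((hW'.mono l2 le_rfl).prodMk hξ)).const_smul _)
    refine ⟨hX, hW', hM', fun j => ?_⟩
    rw [funext (h.run.G_succ k j)]
    have hGl := (hG j).mono (l1.trans (l2.trans l3)) le_rfl
    have hθ : Measurable[known ξ η θ (upTo n (k + 2) (k + 1) (k + 1))] (θ k) :=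
      measurable_worker ξ η θ (Nat.lt_succ_self k)
    exact hGl.add ((h.compw k j).1.comp ((((hM' j).mono l3 le_rfl).sub hGl).prodMk hθ))
  have main : Measurable[known ξ η θ (upTo n (k + 1) k k)] (X k) ∧
      Measurable[known ξ η θ (upTo n (k + 1) k k)] (W k) ∧
      (∀ j, Measurable[known ξ η θ (upTo n (k + 1) k k)] (M k j)) ∧
      (∀ j, Measurable[known ξ η θ (upTo n (k + 1) k k)] (G k j)) := by
    induction k with
    | zero =>
      have hξ : ∀ j, Measurable[known ξ η θ (upTo n (0 + 1) 0 0)] (ξ 0 j) :=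
        fun j => measurable_sample ξ η θ Nat.zero_lt_one
      refine ⟨?_, ?_, fun j => ?_, fun j => ?_⟩
      · rw [funext h.run.X_zero]
        exact measurable_const
      · rw [funext h.run.W_zero]
        exact measurable_const
      · rw [funext (h.run.M_zero j)]
        exact (h.oracle j).1.comp (measurable_const.prodMk (hξ j))
      · rw [funext (h.run.G_zero j)]
        exact (h.oracle j).1.comp (measurable_const.prodMk (hξ j))
    | succ k ih =>
      obtain ⟨h1, h2, h3, h4⟩ := step k ih
      have l1 : known ξ η θ (upTo n (k + 1) k k) ≤
          known ξ η θ (upTo n (k + 1 + 1) (k + 1) (k + 1)) :=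
        known_mono ξ η θ (upTo_mono (by omega) (by omega) (by omega))
      have l2 : known ξ η θ (upTo n (k + 1) (k + 1) k) ≤
          known ξ η θ (upTo n (k + 1 + 1) (k + 1) (k + 1)) :=
        known_mono ξ η θ (upTo_mono (by omega) (by omega) (by omega))
      have l3 : known ξ η θ (upTo n (k + 2) (k + 1) k) ≤
          known ξ η θ (upTo n (k + 1 + 1) (k + 1) (k + 1)) :=
        known_mono ξ η θ (upTo_mono (by omega) (by omega) (by omega))
      exact ⟨h1.mono l1 le_rfl, h2.mono l2 le_rfl, fun j => (h3 j).mono l3 le_rfl, h4⟩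
  have hs := step k main
  exact ⟨main.1, main.2.1, main.2.2.1, main.2.2.2, hs.1, hs.2.1, hs.2.2.1⟩

omit [FiniteDimensional ℝ S] [BorelSpace S] in
theorem memLp_gradient_comp
    (h : Setting μ D νU νV ξ η θ N ρlo ρhi f L Lj σ g αP αD C Cw β γ X₀ X W M G)
    {ℓ : ℝ} (hℓ : 0 ≤ ℓ) {F : S → ℝ} (hF : IsSmooth N ℓ F) {Y : Ω → S} (hY : MemLp Y 2 μ) :
    MemLp (fun ω => gradient F (Y ω)) 2 μ := by
  have hc := hF.continuous_gradient h.ρhi_pos h.lo h.hi h.ρlo_pos hℓ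
  have hdiff : MemLp (fun ω => gradient F (Y ω) - gradient F 0) 2 μ := by
    refine hY.of_le_mul (c := ℓ / ρlo / ρlo)
      ((hc.comp_aestronglyMeasurable hY.1).sub aestronglyMeasurable_const)
      (Filter.Eventually.of_forall fun ω => ?_)
    simpa using hF.norm_gradient_sub_le_mul_norm h.ρhi_pos h.lo h.hi h.ρlo_pos hℓ (Y ω) 0
  exact memLp_of_memLp_sub hdiff (memLp_const (gradient F 0))

theorem memLp_server_step
    (h : Setting μ D νU νV ξ η θ N ρlo ρhi f L Lj σ g αP αD C Cw β γ X₀ X W M G) (k : ℕ)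
    (hX : MemLp (X (k + 1)) 2 μ) (hW : MemLp (W k) 2 μ) :
    MemLp (fun ω => W (k + 1) ω - X (k + 1) ω) 2 μ ∧
      ∫ ω, N (W (k + 1) ω - X (k + 1) ω) ^ 2 ∂μ
        ≤ (1 - αP) * ∫ ω, N (X (k + 1) ω - W k ω) ^ 2 ∂μ := by
  obtain ⟨-, hWm, -, -, hXm, -, -⟩ := h.measurable_iterates k
  have hnot : (Sum.inr (Sum.inl k) : (ℕ × Fin n) ⊕ ℕ ⊕ ℕ) ∉ upTo n (k + 1) k k :=
    Nat.lt_irrefl k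
  have := (h.comp k).memLp_and_integral_le h.αP_le h.lo h.ρlo_pos h.hi (h.rand.known_le _)
    (hXm.sub hWm) (hX.sub hW) (h.rand.server_law k) (h.rand.indep_known_source hnot)
  have heq : ∀ ω, C k (X (k + 1) ω - W k ω) (η k ω) - (X (k + 1) ω - W k ω)
      = W (k + 1) ω - X (k + 1) ω := by
    intro ω
    rw [h.run.W_succ]
    abel
  simpa only [Pi.sub_apply, heq] using this

theorem memLp_worker_step
    (h : Setting μ D νU νV ξ η θ N ρlo ρhi f L Lj σ g αP αD C Cw β γ X₀ X W M G) (k : ℕ)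
    (j : Fin n) (hM : MemLp (M (k + 1) j) 2 μ) (hG : MemLp (G k j) 2 μ) :
    MemLp (fun ω => G (k + 1) j ω - M (k + 1) j ω) 2 μ ∧
      ∫ ω, ‖G (k + 1) j ω - M (k + 1) j ω‖ ^ 2 ∂μ
        ≤ (1 - αD) * ∫ ω, ‖M (k + 1) j ω - G k j ω‖ ^ 2 ∂μ := by
  obtain ⟨-, -, -, hGm, -, -, hMm⟩ := h.measurable_iterates k
  have hnot : (Sum.inr (Sum.inr k) : (ℕ × Fin n) ⊕ ℕ ⊕ ℕ) ∉ upTo n (k + 2) (k + 1) k :=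
    Nat.lt_irrefl k
  have hGm' := (hGm j).mono (known_mono ξ η θ
    (upTo_mono (by omega : k + 1 ≤ k + 2) (by omega : k ≤ k + 1) le_rfl)) le_rfl
  have := (h.compw k j).memLp_and_integral_le (ρlo := 1) (ρhi := 1) h.αD_le
    (by simp) one_pos (by simp) (h.rand.known_le _)
    ((hMm j).sub hGm') (hM.sub hG) (h.rand.worker_law k) (h.rand.indep_known_source hnot)
  have heq : ∀ ω, Cw k j (M (k + 1) j ω - G k j ω) (θ k ω) - (M (k + 1) j ω - G k j ω)
      = G (k + 1) j ω - M (k + 1) j ω := by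
    intro ω
    rw [h.run.G_succ]
    abel
  simpa only [Pi.sub_apply, heq, coe_normSeminorm] using this

theorem memLp_noise
    (h : Setting μ D νU νV ξ η θ N ρlo ρhi f L Lj σ g αP αD C Cw β γ X₀ X W M G) (k : ℕ)
    (j : Fin n) : MemLp (fun ω => g j (W k ω) (ξ k j ω) - gradient (f j) (W k ω)) 2 μ := by
  cases k with
  | zero =>
    simp only [h.run.W_zero]
    -- The starting point is deterministic, so the empty set of sources suffices.
    have hnot : (Sum.inl (0, j) : (ℕ × Fin n) ⊕ ℕ ⊕ ℕ) ∉ (∅ : Set _) := id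
    exact ((h.oracle j).noise_memLp_and_integral_le (W := fun _ => X₀) (h.measurable_gradient j)
      (h.rand.known_le _) measurable_const (h.rand.sample_law 0 j)
      (h.rand.indep_known_source hnot)).1
  | succ k =>
    obtain ⟨-, -, -, -, -, hW, -⟩ := h.measurable_iterates k
    have hnot : (Sum.inl (k + 1, j) : (ℕ × Fin n) ⊕ ℕ ⊕ ℕ) ∉ upTo n (k + 1) (k + 1) k :=
      Nat.lt_irrefl (k + 1)
    exact ((h.oracle j).noise_memLp_and_integral_le (h.measurable_gradient j)
      (h.rand.known_le _) hW (h.rand.sample_law (k + 1) j) (h.rand.indep_known_source hnot)).1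

omit [FiniteDimensional ℝ S] [CompleteSpace S] [MeasurableSpace S] [BorelSpace S]
  [IsProbabilityMeasure μ] in
theorem memLp_serverEstimator (k : ℕ) (hG : ∀ j, MemLp (G k j) 2 μ) :
    MemLp (serverEstimator G k) 2 μ :=
  (memLp_finsetSum Finset.univ fun j _ => hG j).const_smul (n : ℝ)⁻¹

/-- Each new iterate differs from a square-integrable variable by one whose second moment is
controlled: by the LMO radius for X, by the contraction property for W and G, and by the oracle
variance for the stochastic gradient inside M. -/
theorem memLp_iterates
    (h : Setting μ D νU νV ξ η θ N ρlo ρhi f L Lj σ g αP αD C Cw β γ X₀ X W M G) (k : ℕ) :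
    MemLp (X k) 2 μ ∧ MemLp (W k) 2 μ ∧ (∀ j, MemLp (M k j) 2 μ) ∧ ∀ j, MemLp (G k j) 2 μ := by
  induction k with
  | zero =>
    have hg : ∀ j, MemLp (fun ω => g j X₀ (ξ 0 j ω)) 2 μ := by
      intro j
      have h1 := h.memLp_noise 0 j
      simp only [h.run.W_zero] at h1
      exact memLp_of_memLp_sub h1 (memLp_const (gradient (f j) X₀))
    refine ⟨?_, ?_, fun j => ?_, fun j => ?_⟩
    · rw [funext h.run.X_zero]
      exact memLp_const _
    · rw [funext h.run.W_zero]
      exact memLp_const _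
    · rw [funext (h.run.M_zero j)]
      exact hg j
    · rw [funext (h.run.G_zero j)]
      exact hg j
  | succ k ih =>
    obtain ⟨hX, hW, hM, hG⟩ := ih
    have hX' : MemLp (X (k + 1)) 2 μ := by
      have hmeas : Measurable (X (k + 1)) :=
        (h.measurable_iterates k).2.2.2.2.1.mono (h.rand.known_le _) le_rfl
      have hd : MemLp (fun ω => X (k + 1) ω - X k ω) 2 μ := by
        refine (memLp_serverEstimator k hG).of_le_mul (c := ρhi * (γ * ρhi))
          (hmeas.aestronglyMeasurable.sub hX.1) (Filter.Eventually.of_forall fun ω => ?_)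
        have h1 := (h.run.X_succ k ω).1
        have h2 := dualNorm_le_mul_norm h.ρhi_pos h.hi (serverEstimator G k ω)
        have h3 := h.hi (X (k + 1) ω - X k ω)
        have h4 := h.ρhi_pos
        have h5 := h.γ_pos
        calc ‖X (k + 1) ω - X k ω‖ ≤ ρhi * N (X (k + 1) ω - X k ω) := h3
          _ ≤ ρhi * (γ * (ρhi * ‖serverEstimator G k ω‖)) := by
            gcongr
            exact h1.trans (by gcongr)
          _ = _ := by ring
      exact memLp_of_memLp_sub hd hX
    have hW' : MemLp (W (k + 1)) 2 μ := by
      exact memLp_of_memLp_sub (h.memLp_server_step k hX' hW).1 hX'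
    have hM' : ∀ j, MemLp (M (k + 1) j) 2 μ := by
      intro j
      rw [funext (h.run.M_succ k j)]
      have h1 : MemLp (fun ω => g j (W (k + 1) ω) (ξ (k + 1) j ω)) 2 μ := by
        exact memLp_of_memLp_sub (h.memLp_noise (k + 1) j)
          (h.memLp_gradient_comp (h.Lj_nonneg j) (h.smoothj j) hW')
      exact ((hM j).const_smul _).add (h1.const_smul _)
    refine ⟨hX', hW', hM', fun j => ?_⟩
    exact memLp_of_memLp_sub (h.memLp_worker_step k j (hM' j) (hG j)).1 (hM' j)

end Setting

end Run

end EF21Muon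

/-! ### One-step recursions for the four errors. -/

namespace EF21Muon

/-- Nonnegativity of q replaces its integrability, which therefore never has to be checked. -/
theorem integral_le_linear_combination {Ω : Type*} [MeasurableSpace Ω] {μ : Measure Ω}
    {q x y z : Ω → ℝ} {a b c : ℝ} (hx : Integrable x μ) (hy : Integrable y μ)
    (hz : Integrable z μ) (h0 : ∀ ω, 0 ≤ q ω) (h : ∀ ω, q ω ≤ a * x ω + b * y ω + c * z ω) :
    ∫ ω, q ω ∂μ ≤ a * ∫ ω, x ω ∂μ + b * ∫ ω, y ω ∂μ + c * ∫ ω, z ω ∂μ := by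
  have hxy : Integrable (fun ω => a * x ω + b * y ω) μ := (hx.const_mul a).add (hy.const_mul b)
  have hxyz : Integrable (fun ω => a * x ω + b * y ω + c * z ω) μ := hxy.add (hz.const_mul c)
  have h1 := integral_mono_of_nonneg (μ := μ) (Filter.Eventually.of_forall h0) hxyz
    (Filter.Eventually.of_forall h)
  rwa [integral_add hxy (hz.const_mul c), integral_add (hx.const_mul a) (hy.const_mul b),
    integral_const_mul, integral_const_mul, integral_const_mul] at h1

/-- Convexity of the square with weights 1 - β and β, the second on (1 - β)q/β + r, keeps the
contraction factor of p exact; that second term is then split in two. -/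
theorem norm_momentum_sq_le {S : Type*} [NormedAddCommGroup S] [InnerProductSpace ℝ S] {β : ℝ}
    (hβ : 0 < β) (hβ1 : β ≤ 1) (p q r : S) :
    ‖(1 - β) • p + ((1 - β) • q + β • r)‖ ^ 2
      ≤ (1 - β) * ‖p‖ ^ 2 + 2 / β * ‖q‖ ^ 2 + 2 * β * ‖r‖ ^ 2 := by
  have h1 : ‖(1 - β) • p + ((1 - β) • q + β • r)‖ ≤ (1 - β) * ‖p‖ + ((1 - β) * ‖q‖ + β * ‖r‖) := by
    refine (norm_add_le _ _).trans (add_le_add ?_ ((norm_add_le _ _).trans (add_le_add ?_ ?_))) <;>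
      rw [norm_smul, Real.norm_of_nonneg (by linarith)]
  refine (pow_le_pow_left₀ (norm_nonneg _) h1 2).trans ?_
  generalize ‖p‖ = P
  generalize hQ : ‖q‖ = Q
  generalize ‖r‖ = R
  have h2 : (1 - β) * P ^ 2 + β * ((1 - β) * Q / β + R) ^ 2
      - ((1 - β) * P + ((1 - β) * Q + β * R)) ^ 2
      = β * (1 - β) * (P - ((1 - β) * Q / β + R)) ^ 2 := by
    field_simp
    ring
  have h3 : 0 ≤ β * (1 - β) * (P - ((1 - β) * Q / β + R)) ^ 2 :=
    mul_nonneg (mul_nonneg hβ.le (by linarith)) (sq_nonneg _)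
  have h4 : 2 / β * Q ^ 2 + 2 * β * R ^ 2 - β * ((1 - β) * Q / β + R) ^ 2
      = β * ((1 - β) * Q / β - R) ^ 2 + 2 * (2 - β) * Q ^ 2 := by
    field_simp
    ring
  have h5 : 0 ≤ β * ((1 - β) * Q / β - R) ^ 2 + 2 * (2 - β) * Q ^ 2 := by
    have : 0 ≤ 2 - β := by linarith
    positivity
  linarith

theorem norm_inv_smul_sum_sq_le {S : Type*} [NormedAddCommGroup S] [InnerProductSpace ℝ S] {n : ℕ}
    (hn : 1 ≤ n) (x : Fin n → S) :
    ‖(n : ℝ)⁻¹ • ∑ j, x j‖ ^ 2 ≤ (n : ℝ)⁻¹ * ∑ j, ‖x j‖ ^ 2 := by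
  have hn' : (0 : ℝ) < n := by exact_mod_cast hn
  have h1 : ‖∑ j, x j‖ ^ 2 ≤ n * ∑ j, ‖x j‖ ^ 2 := by
    refine (pow_le_pow_left₀ (norm_nonneg _) (norm_sum_le _ _) 2).trans ?_
    simpa using sq_sum_le_card_mul_sum_sq (s := Finset.univ) (f := fun j => ‖x j‖)
  rw [norm_smul, mul_pow, norm_inv, Real.norm_natCast]
  calc ((n : ℝ)⁻¹) ^ 2 * ‖∑ j, x j‖ ^ 2 ≤ ((n : ℝ)⁻¹) ^ 2 * (n * ∑ j, ‖x j‖ ^ 2) := by gcongr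
    _ = _ := by
      field_simp

section Run

variable {S : Type*} [NormedAddCommGroup S] [InnerProductSpace ℝ S] [FiniteDimensional ℝ S]
  [CompleteSpace S] [MeasurableSpace S] [BorelSpace S]
  {Ω : Type*} [mΩ : MeasurableSpace Ω] {μ : Measure Ω} [IsProbabilityMeasure μ]
  {n : ℕ} {Ξ : Fin n → Type*} [∀ j, MeasurableSpace (Ξ j)]
  {U V : ℕ → Type*} [∀ k, MeasurableSpace (U k)] [∀ k, MeasurableSpace (V k)]
  {D : ∀ j, Measure (Ξ j)} {νU : ∀ k, Measure (U k)} {νV : ∀ k, Measure (V k)}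
  {ξ : ℕ → ∀ j, Ω → Ξ j} {η : ∀ k, Ω → U k} {θ : ∀ k, Ω → V k}
  {N : Seminorm ℝ S} {ρlo ρhi : ℝ} {f : Fin n → S → ℝ} {L : ℝ} {Lj : Fin n → ℝ} {σ : ℝ}
  {g : ∀ j, S → Ξ j → S} {αP αD : ℝ} {C : ∀ k, S → U k → S} {Cw : ∀ k, Fin n → S → V k → S}
  {β γ : ℝ} {X₀ : S} {X W : ℕ → Ω → S} {M G : ℕ → Fin n → Ω → S}

namespace Setting

/-- Contract, then apply Young with parameter αP/2: (1 - αP)(1 + αP/2) ≤ 1 - αP/2 and (1 - αP)(1 +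
2/αP) ≤ 2/αP. -/
theorem integral_server_error_le
    (h : Setting μ D νU νV ξ η θ N ρlo ρhi f L Lj σ g αP αD C Cw β γ X₀ X W M G) (k : ℕ) :
    ∫ ω, N (W (k + 1) ω - X (k + 1) ω) ^ 2 ∂μ ≤ (1 - αP / 2) * ∫ ω, N (W k ω - X k ω) ^ 2 ∂μ
      + 2 / αP * ∫ ω, N (X (k + 1) ω - X k ω) ^ 2 ∂μ := by
  obtain ⟨hX, hW, -, -⟩ := h.memLp_iterates k
  obtain ⟨hX', -, -, -⟩ := h.memLp_iterates (k + 1)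
  have i1 := integrable_seminorm_sq h.lo h.ρlo_pos (hW.sub hX)
  have i2 := integrable_seminorm_sq h.lo h.ρlo_pos (hX'.sub hX)
  simp only [Pi.sub_apply] at i1 i2
  have hα := h.αP_pos
  have hα1 := h.αP_le
  have h1 : ∫ ω, N (X (k + 1) ω - W k ω) ^ 2 ∂μ ≤ (1 + αP / 2) * ∫ ω, N (W k ω - X k ω) ^ 2 ∂μ
      + (1 + (αP / 2)⁻¹) * ∫ ω, N (X (k + 1) ω - X k ω) ^ 2 ∂μ + 0 * ∫ _, (0 : ℝ) ∂μ := by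
    refine integral_le_linear_combination i1 i2 (integrable_const _) (fun ω => by positivity)
      fun ω => ?_
    have := seminorm_add_sq_le (N := N) (αP / 2) (by positivity) (-(W k ω - X k ω))
      (X (k + 1) ω - X k ω)
    rw [map_neg_eq_map, neg_sub, sub_add_sub_comm, add_comm (X k ω), add_sub_add_right_eq_sub]
      at this
    linarith
  rw [zero_mul, add_zero] at h1
  refine (h.memLp_server_step k hX' hW).2.trans
    ((mul_le_mul_of_nonneg_left h1 (by linarith)).trans ?_)
  have n1 : 0 ≤ ∫ ω, N (W k ω - X k ω) ^ 2 ∂μ := integral_nonneg fun ω => by positivity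
  have n2 : 0 ≤ ∫ ω, N (X (k + 1) ω - X k ω) ^ 2 ∂μ := integral_nonneg fun ω => by positivity
  have c1 : (1 - αP) * (1 + αP / 2) ≤ 1 - αP / 2 := by nlinarith
  have c2 : (1 - αP) * (1 + (αP / 2)⁻¹) ≤ 2 / αP := by
    have : (1 - αP) * (1 + (αP / 2)⁻¹) = 2 / αP - 1 - αP := by
      field_simp
      ring
    linarith
  linarith [mul_le_mul_of_nonneg_right c1 n1, mul_le_mul_of_nonneg_right c2 n2]

/-- This is the noiseless part of the momentum update: old error, drift of the gradient along the
step, and bias from evaluating at W instead of X. It serves both the single workers and their mean.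
-/
theorem integral_momentum_le
    (h : Setting μ D νU νV ξ η θ N ρlo ρhi f L Lj σ g αP αD C Cw β γ X₀ X W M G) (k : ℕ)
    {ℓ : ℝ} (hℓ : 0 ≤ ℓ) {F : S → ℝ} (hF : IsSmooth N ℓ F) {A : Ω → S} (hA : MemLp A 2 μ) :
    ∫ ω, ‖(1 - β) • (A ω - gradient F (X k ω))
        + ((1 - β) • (gradient F (X k ω) - gradient F (X (k + 1) ω))
          + β • (gradient F (W (k + 1) ω) - gradient F (X (k + 1) ω)))‖ ^ 2 ∂μ
      ≤ (1 - β) * ∫ ω, ‖A ω - gradient F (X k ω)‖ ^ 2 ∂μ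
        + 2 / β * (ℓ ^ 2 / ρlo ^ 2) * ∫ ω, N (X (k + 1) ω - X k ω) ^ 2 ∂μ
        + 2 * β * (ℓ ^ 2 / ρlo ^ 2) * ∫ ω, N (W (k + 1) ω - X (k + 1) ω) ^ 2 ∂μ := by
  obtain ⟨hX, -, -, -⟩ := h.memLp_iterates k
  obtain ⟨hX', hW', -, -⟩ := h.memLp_iterates (k + 1)
  have i1 := (hA.sub (h.memLp_gradient_comp hℓ hF hX)).norm.integrable_sq
  have i2 := integrable_seminorm_sq h.lo h.ρlo_pos (hX'.sub hX)
  have i3 := integrable_seminorm_sq h.lo h.ρlo_pos (hW'.sub hX')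
  have hβ := h.β_pos
  refine integral_le_linear_combination i1 i2 i3 (fun ω => by positivity) fun ω => ?_
  refine (norm_momentum_sq_le hβ h.β_le _ _ _).trans ?_
  have h1 := hF.norm_gradient_sub_sq_le h.ρhi_pos h.lo h.hi h.ρlo_pos (X k ω) (X (k + 1) ω)
  have h2 := hF.norm_gradient_sub_sq_le h.ρhi_pos h.lo h.hi h.ρlo_pos (W (k + 1) ω) (X (k + 1) ω)
  rw [map_sub_rev] at h1
  have h3 := mul_le_mul_of_nonneg_left h1 (by positivity : 0 ≤ 2 / β)
  have h4 := mul_le_mul_of_nonneg_left h2 (by positivity : 0 ≤ 2 * β)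
  linarith

theorem integral_worker_momentum_le
    (h : Setting μ D νU νV ξ η θ N ρlo ρhi f L Lj σ g αP αD C Cw β γ X₀ X W M G) (k : ℕ)
    (j : Fin n) :
    ∫ ω, ‖M (k + 1) j ω - gradient (f j) (X (k + 1) ω)‖ ^ 2 ∂μ
      ≤ (1 - β) * ∫ ω, ‖M k j ω - gradient (f j) (X k ω)‖ ^ 2 ∂μ
        + 2 / β * (Lj j ^ 2 / ρlo ^ 2) * ∫ ω, N (X (k + 1) ω - X k ω) ^ 2 ∂μ
        + 2 * β * (Lj j ^ 2 / ρlo ^ 2) * ∫ ω, N (W (k + 1) ω - X (k + 1) ω) ^ 2 ∂μ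
        + β ^ 2 * σ ^ 2 := by
  obtain ⟨hXm, -, hMm, -, hXm', hWm', -⟩ := h.measurable_iterates k
  obtain ⟨hX, -, hM, -⟩ := h.memLp_iterates k
  obtain ⟨hX', hW', -, -⟩ := h.memLp_iterates (k + 1)
  have hnot : (Sum.inl (k + 1, j) : (ℕ × Fin n) ⊕ ℕ ⊕ ℕ) ∉ upTo n (k + 1) (k + 1) k :=
    Nat.lt_irrefl (k + 1)
  have l1 : known ξ η θ (upTo n (k + 1) k k) ≤ known ξ η θ (upTo n (k + 1) (k + 1) k) :=
    known_mono ξ η θ (upTo_mono le_rfl (by omega) le_rfl)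
  have hg := h.measurable_gradient j
  have gX := hg.comp (hXm.mono l1 le_rfl)
  have gX' := hg.comp (hXm'.mono l1 le_rfl)
  have gW' := hg.comp hWm'
  have hY := (((hMm j).mono l1 le_rfl).sub gX).const_smul (1 - β) |>.add
    (((gX.sub gX').const_smul (1 - β)).add ((gW'.sub gX').const_smul β))
  have LX := h.memLp_gradient_comp (h.Lj_nonneg j) (h.smoothj j) hX
  have LX' := h.memLp_gradient_comp (h.Lj_nonneg j) (h.smoothj j) hX'
  have LW' := h.memLp_gradient_comp (h.Lj_nonneg j) (h.smoothj j) hW'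
  have hYL := (((hM j).sub LX).const_smul (1 - β)).add
    (((LX.sub LX').const_smul (1 - β)).add ((LW'.sub LX').const_smul β))
  have h1 := (h.oracle j).integral_norm_add_smul_noise_sq_le hg (h.rand.known_le _) hWm' hY hYL
    (h.rand.sample_law (k + 1) j) (h.rand.indep_known_source hnot) β
  have h2 := h.integral_momentum_le k (h.Lj_nonneg j) (h.smoothj j) (hM j)
  refine le_trans (le_of_eq ?_) (h1.trans (add_le_add_left h2 _))
  refine integral_congr_ae (Filter.Eventually.of_forall fun ω => ?_)
  simp only [Pi.add_apply, Pi.sub_apply, Pi.smul_apply, Function.comp_apply]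
  rw [h.run.M_succ]
  congr 2
  module

/-- The mean momentum, here `serverEstimator` applied to `M`, is itself a momentum sequence for f.
Treating it directly keeps the constant L and the 1/n reduction of variance. -/
theorem integral_server_momentum_le
    (h : Setting μ D νU νV ξ η θ N ρlo ρhi f L Lj σ g αP αD C Cw β γ X₀ X W M G) (k : ℕ) :
    ∫ ω, ‖serverEstimator M (k + 1) ω - gradient (objective f) (X (k + 1) ω)‖ ^ 2 ∂μ
      ≤ (1 - β) * ∫ ω, ‖serverEstimator M k ω - gradient (objective f) (X k ω)‖ ^ 2 ∂μ
        + 2 / β * (L ^ 2 / ρlo ^ 2) * ∫ ω, N (X (k + 1) ω - X k ω) ^ 2 ∂μ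
        + 2 * β * (L ^ 2 / ρlo ^ 2) * ∫ ω, N (W (k + 1) ω - X (k + 1) ω) ^ 2 ∂μ
        + β ^ 2 * σ ^ 2 / n := by
  obtain ⟨hXm, -, hMm, -, hXm', hWm', -⟩ := h.measurable_iterates k
  obtain ⟨hX, -, hM, -⟩ := h.memLp_iterates k
  obtain ⟨hX', hW', -, -⟩ := h.memLp_iterates (k + 1)
  have hn : (n : ℝ) ≠ 0 := by exact_mod_cast (Nat.one_le_iff_ne_zero.1 h.one_le)
  have hnot : ∀ j, (Sum.inl (k + 1, j) : (ℕ × Fin n) ⊕ ℕ ⊕ ℕ) ∉ upTo n (k + 1) (k + 1) k :=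
    fun j => Nat.lt_irrefl (k + 1)
  have l1 : known ξ η θ (upTo n (k + 1) k k) ≤ known ξ η θ (upTo n (k + 1) (k + 1) k) :=
    known_mono ξ η θ (upTo_mono le_rfl (by omega) le_rfl)
  have hg : Measurable (gradient (objective f)) :=
    (h.smooth.continuous_gradient h.ρhi_pos h.lo h.hi h.ρlo_pos h.L_nonneg).measurable
  have gX := hg.comp (hXm.mono l1 le_rfl)
  have gX' := hg.comp (hXm'.mono l1 le_rfl)
  have gW' := hg.comp hWm'
  have hMs : Measurable[known ξ η θ (upTo n (k + 1) (k + 1) k)] (serverEstimator M k) :=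
    (Finset.measurable_fun_sum Finset.univ fun j _ => (hMm j).mono l1 le_rfl).const_smul (n : ℝ)⁻¹
  have hMLs : MemLp (serverEstimator M k) 2 μ := memLp_serverEstimator k hM
  have hY := (hMs.sub gX).const_smul (1 - β) |>.add
    (((gX.sub gX').const_smul (1 - β)).add ((gW'.sub gX').const_smul β))
  have LX := h.memLp_gradient_comp h.L_nonneg h.smooth hX
  have LX' := h.memLp_gradient_comp h.L_nonneg h.smooth hX'
  have LW' := h.memLp_gradient_comp h.L_nonneg h.smooth hW'
  have hYL := ((hMLs.sub LX).const_smul (1 - β)).add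
    (((LX.sub LX').const_smul (1 - β)).add ((LW'.sub LX').const_smul β))
  have h1 := h.rand.integral_norm_add_sum_noise_sq_le h.oracle h.measurable_gradient hnot hY hWm'
    hYL (β * (n : ℝ)⁻¹)
  have h2 := h.integral_momentum_le k h.L_nonneg h.smooth hMLs
  have h3 : (n : ℝ) * ((β * (n : ℝ)⁻¹) ^ 2 * σ ^ 2) = β ^ 2 * σ ^ 2 / n := by
    field_simp
  rw [h3] at h1
  refine le_trans (le_of_eq ?_) (h1.trans (add_le_add_left h2 _))
  refine integral_congr_ae (Filter.Eventually.of_forall fun ω => ?_)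
  have h4 : serverEstimator M (k + 1) ω = (1 - β) • serverEstimator M k ω
      + (β * (n : ℝ)⁻¹) • ∑ j, g j (W (k + 1) ω) (ξ (k + 1) j ω) := by
    simp only [serverEstimator, h.run.M_succ, Finset.sum_add_distrib, ← Finset.smul_sum]
    module
  have h5 : (β * (n : ℝ)⁻¹) • ∑ j, gradient (f j) (W (k + 1) ω)
      = β • gradient (objective f) (W (k + 1) ω) := by
    rw [gradient_objective fun j => (h.smoothj j).1, smul_smul]
  simp only [Pi.add_apply, Pi.sub_apply, Pi.smul_apply, Function.comp_apply]
  rw [h4, Finset.sum_sub_distrib, smul_sub (β * (n : ℝ)⁻¹), h5]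
  congr 2
  module

/-- The sample noise in M^{k+1} - G^k is removed by orthogonality before Young is applied, so it
costs only (1 - αD)β²σ². Young with αD/2 gives 2β²/αD, and splitting ∇f_j(W^{k+1}) - M_j^k into
three pieces turns this into 6β²/αD. -/
theorem integral_worker_error_le
    (h : Setting μ D νU νV ξ η θ N ρlo ρhi f L Lj σ g αP αD C Cw β γ X₀ X W M G) (k : ℕ)
    (j : Fin n) :
    ∫ ω, ‖G (k + 1) j ω - M (k + 1) j ω‖ ^ 2 ∂μ
      ≤ (1 - αD / 2) * ∫ ω, ‖G k j ω - M k j ω‖ ^ 2 ∂μ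
        + 6 * β ^ 2 / αD * (∫ ω, ‖M k j ω - gradient (f j) (X k ω)‖ ^ 2 ∂μ
          + Lj j ^ 2 / ρlo ^ 2 * ∫ ω, N (X (k + 1) ω - X k ω) ^ 2 ∂μ
          + Lj j ^ 2 / ρlo ^ 2 * ∫ ω, N (W (k + 1) ω - X (k + 1) ω) ^ 2 ∂μ)
        + (1 - αD) * β ^ 2 * σ ^ 2 := by
  obtain ⟨hXm, -, hMm, hGm, hXm', hWm', -⟩ := h.measurable_iterates k
  obtain ⟨hX, -, hM, hG⟩ := h.memLp_iterates k
  obtain ⟨hX', hW', hM', -⟩ := h.memLp_iterates (k + 1)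
  have hα := h.αD_pos
  have hα1 := h.αD_le
  have hnot : (Sum.inl (k + 1, j) : (ℕ × Fin n) ⊕ ℕ ⊕ ℕ) ∉ upTo n (k + 1) (k + 1) k :=
    Nat.lt_irrefl (k + 1)
  have l1 : known ξ η θ (upTo n (k + 1) k k) ≤ known ξ η θ (upTo n (k + 1) (k + 1) k) :=
    known_mono ξ η θ (upTo_mono le_rfl (by omega) le_rfl)
  have hg := h.measurable_gradient j
  have hMl := (hMm j).mono l1 le_rfl
  have hY := (hMl.sub ((hGm j).mono l1 le_rfl)).add (((hg.comp hWm').sub hMl).const_smul β)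
  have LX := h.memLp_gradient_comp (h.Lj_nonneg j) (h.smoothj j) hX
  have LW' := h.memLp_gradient_comp (h.Lj_nonneg j) (h.smoothj j) hW'
  have hYL := ((hM j).sub (hG j)).add ((LW'.sub (hM j)).const_smul β)
  have h1 := (h.oracle j).integral_norm_add_smul_noise_sq_le hg (h.rand.known_le _) hWm' hY hYL
    (h.rand.sample_law (k + 1) j) (h.rand.indep_known_source hnot) β
  have h2 : ∫ ω, ‖M (k + 1) j ω - G k j ω‖ ^ 2 ∂μ
      ≤ ∫ ω, ‖(M k j ω - G k j ω) + β • (gradient (f j) (W (k + 1) ω) - M k j ω)‖ ^ 2 ∂μ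
        + β ^ 2 * σ ^ 2 := by
    refine le_trans (le_of_eq ?_) h1
    refine integral_congr_ae (Filter.Eventually.of_forall fun ω => ?_)
    simp only [Pi.add_apply, Pi.sub_apply, Pi.smul_apply, Function.comp_apply]
    rw [h.run.M_succ]
    congr 2
    module
  have iG := ((hG j).sub (hM j)).norm.integrable_sq
  have iV := (LW'.sub (hM j)).norm.integrable_sq
  have i1 := ((hM j).sub LX).norm.integrable_sq
  have i2 := integrable_seminorm_sq h.lo h.ρlo_pos (hX'.sub hX)
  have i3 := integrable_seminorm_sq h.lo h.ρlo_pos (hW'.sub hX')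
  simp only [Pi.sub_apply] at iG iV i1 i2 i3
  have h3 : ∫ ω, ‖(M k j ω - G k j ω) + β • (gradient (f j) (W (k + 1) ω) - M k j ω)‖ ^ 2 ∂μ
      ≤ (1 + αD / 2) * ∫ ω, ‖G k j ω - M k j ω‖ ^ 2 ∂μ
        + (1 + (αD / 2)⁻¹) * β ^ 2 * ∫ ω, ‖gradient (f j) (W (k + 1) ω) - M k j ω‖ ^ 2 ∂μ
        + 0 * ∫ _, (0 : ℝ) ∂μ := by
    refine integral_le_linear_combination iG iV (integrable_const _) (fun ω => by positivity)
      fun ω => ?_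
    have := norm_add_sq_le_young (αD / 2) (by positivity) (M k j ω - G k j ω)
      (β • (gradient (f j) (W (k + 1) ω) - M k j ω))
    rw [norm_smul, mul_pow, Real.norm_eq_abs, sq_abs, norm_sub_rev (M k j ω)] at this
    linarith
  rw [zero_mul, add_zero] at h3
  have h4 : ∫ ω, ‖gradient (f j) (W (k + 1) ω) - M k j ω‖ ^ 2 ∂μ
      ≤ 3 * ∫ ω, ‖M k j ω - gradient (f j) (X k ω)‖ ^ 2 ∂μ
        + 3 * (Lj j ^ 2 / ρlo ^ 2) * ∫ ω, N (X (k + 1) ω - X k ω) ^ 2 ∂μ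
        + 3 * (Lj j ^ 2 / ρlo ^ 2) * ∫ ω, N (W (k + 1) ω - X (k + 1) ω) ^ 2 ∂μ := by
    refine integral_le_linear_combination i1 i2 i3 (fun ω => by positivity) fun ω => ?_
    have e1 := (h.smoothj j).norm_gradient_sub_sq_le h.ρhi_pos h.lo h.hi h.ρlo_pos
      (X (k + 1) ω) (X k ω)
    have e2 := (h.smoothj j).norm_gradient_sub_sq_le h.ρhi_pos h.lo h.hi h.ρlo_pos
      (W (k + 1) ω) (X (k + 1) ω)
    have e3 : ‖gradient (f j) (W (k + 1) ω) - M k j ω‖ ≤ ‖M k j ω - gradient (f j) (X k ω)‖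
        + ‖gradient (f j) (X (k + 1) ω) - gradient (f j) (X k ω)‖
        + ‖gradient (f j) (W (k + 1) ω) - gradient (f j) (X (k + 1) ω)‖ := by
      rw [norm_sub_rev (M k j ω)]
      refine le_trans (le_of_eq ?_) norm_add₃_le
      congr 1
      abel
    refine (pow_le_pow_left₀ (norm_nonneg _) e3 2).trans ?_
    generalize ‖M k j ω - gradient (f j) (X k ω)‖ = a at *
    generalize ‖gradient (f j) (X (k + 1) ω) - gradient (f j) (X k ω)‖ = b at *
    generalize ‖gradient (f j) (W (k + 1) ω) - gradient (f j) (X (k + 1) ω)‖ = c at *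
    nlinarith [sq_nonneg (a - b), sq_nonneg (a - c), sq_nonneg (b - c)]
  have h5 := (h.memLp_worker_step k j (hM' j) (hG j)).2
  have n1 : 0 ≤ ∫ ω, ‖G k j ω - M k j ω‖ ^ 2 ∂μ := integral_nonneg fun ω => by positivity
  have n2 : 0 ≤ ∫ ω, ‖gradient (f j) (W (k + 1) ω) - M k j ω‖ ^ 2 ∂μ :=
    integral_nonneg fun ω => by positivity
  have c1 : (1 - αD) * (1 + αD / 2) ≤ 1 - αD / 2 := by nlinarith
  have c2 : (1 - αD) * ((1 + (αD / 2)⁻¹) * β ^ 2) ≤ 2 * β ^ 2 / αD := by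
    have : 2 * β ^ 2 / αD - (1 - αD) * ((1 + (αD / 2)⁻¹) * β ^ 2) = (1 + αD) * β ^ 2 := by
      field_simp
      ring
    have : 0 ≤ (1 + αD) * β ^ 2 := by positivity
    linarith
  have h6 := mul_le_mul_of_nonneg_left (h2.trans (add_le_add_left h3 _))
    (by linarith : 0 ≤ 1 - αD)
  have h7 := mul_le_mul_of_nonneg_left h4 (by positivity : 0 ≤ 2 * β ^ 2 / αD)
  have h8 := mul_le_mul_of_nonneg_right c1 n1
  have h9 := mul_le_mul_of_nonneg_right c2 n2
  have h10 : ∀ x y z : ℝ, 2 * β ^ 2 / αD * (3 * x + 3 * (Lj j ^ 2 / ρlo ^ 2) * y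
      + 3 * (Lj j ^ 2 / ρlo ^ 2) * z) = 6 * β ^ 2 / αD * (x + Lj j ^ 2 / ρlo ^ 2 * y
      + Lj j ^ 2 / ρlo ^ 2 * z) := fun x y z => by ring
  rw [h10] at h7
  linarith

theorem integral_worker_momentum_zero_le
    (h : Setting μ D νU νV ξ η θ N ρlo ρhi f L Lj σ g αP αD C Cw β γ X₀ X W M G) (j : Fin n) :
    ∫ ω, ‖M 0 j ω - gradient (f j) (X 0 ω)‖ ^ 2 ∂μ ≤ σ ^ 2 := by
  have hnot : (Sum.inl (0, j) : (ℕ × Fin n) ⊕ ℕ ⊕ ℕ) ∉ (∅ : Set _) := id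
  simp only [h.run.M_zero, h.run.X_zero]
  exact ((h.oracle j).noise_memLp_and_integral_le (W := fun _ => X₀) (h.measurable_gradient j)
    (h.rand.known_le _) measurable_const (h.rand.sample_law 0 j)
    (h.rand.indep_known_source hnot)).2

theorem integral_server_momentum_zero_le
    (h : Setting μ D νU νV ξ η θ N ρlo ρhi f L Lj σ g αP αD C Cw β γ X₀ X W M G) :
    ∫ ω, ‖serverEstimator M 0 ω - gradient (objective f) (X 0 ω)‖ ^ 2 ∂μ ≤ σ ^ 2 / n := by
  have hn : (n : ℝ) ≠ 0 := by exact_mod_cast (Nat.one_le_iff_ne_zero.1 h.one_le)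
  have hnot : ∀ j, (Sum.inl (0, j) : (ℕ × Fin n) ⊕ ℕ ⊕ ℕ) ∉ (∅ : Set _) := fun _ => id
  have h1 := h.rand.integral_norm_add_sum_noise_sq_le h.oracle h.measurable_gradient hnot
    (Y := fun _ => 0) (W := fun _ => X₀) measurable_const measurable_const (memLp_const 0) (n : ℝ)⁻¹
  have h3 : (n : ℝ) * (((n : ℝ)⁻¹) ^ 2 * σ ^ 2) = σ ^ 2 / n := by
    field_simp
  rw [h3] at h1
  simp only [zero_add, Finset.sum_sub_distrib, smul_sub, norm_zero, ne_eq, OfNat.ofNat_ne_zero,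
    not_false_eq_true, zero_pow, integral_zero] at h1
  simpa only [serverEstimator, h.run.M_zero, h.run.X_zero,
    gradient_objective fun j => (h.smoothj j).1] using h1

end Setting

end Run

end EF21Muon

/-! ### Summing the recursions and tracking constants. -/

namespace EF21Muon

theorem sum_add_le_of_contraction {u e : ℕ → ℝ} {r : ℝ}
    (h : ∀ k, u (k + 1) ≤ (1 - r) * u k + e k) (K : ℕ) :
    r * ∑ k ∈ Finset.range K, u k + u K ≤ u 0 + ∑ k ∈ Finset.range K, e k := by
  induction K with
  | zero => simp
  | succ K ih =>
    rw [Finset.sum_range_succ, Finset.sum_range_succ]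
    linarith [h K]

theorem average_le {n : ℕ} (hn : 1 ≤ n) {u x y l : Fin n → ℝ} {A B E Q : ℝ}
    (h : ∀ j, u j ≤ A * x j + B * y j + E * l j + Q) :
    (n : ℝ)⁻¹ * ∑ j, u j ≤ A * ((n : ℝ)⁻¹ * ∑ j, x j) + B * ((n : ℝ)⁻¹ * ∑ j, y j)
      + E * ((n : ℝ)⁻¹ * ∑ j, l j) + Q := by
  have hn' : (0 : ℝ) < n := by exact_mod_cast hn
  have h1 := Finset.sum_le_sum fun j (_ : j ∈ Finset.univ) => h j
  simp only [Finset.sum_add_distrib, ← Finset.mul_sum, Finset.sum_const, Finset.card_univ,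
    Fintype.card_fin, nsmul_eq_mul] at h1
  have h2 := mul_le_mul_of_nonneg_left h1 (inv_pos.2 hn').le
  have h3 : (n : ℝ)⁻¹ * (n * Q) = Q := by
    field_simp
  linarith

/-- Here q is both the initial error and the per-sample variance: σ²/n for the mean, σ² for the
workers. The number of iterations is t. -/
theorem sum_momentum_le {β αP s x q t Sd Sw : ℝ} (hβ : 0 < β) (hαP : 0 < αP) (hx : 0 ≤ x)
    (hw : Sw ≤ 4 / αP ^ 2 * Sd)
    (h : β * s ≤ q + (2 / β * x * Sd + 2 * β * x * Sw + β ^ 2 * (t * q))) :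
    s ≤ q / β + t * β * q + x * (2 / β ^ 2 + 8 / αP ^ 2) * Sd := by
  have h1 := mul_le_mul_of_nonneg_left hw (by positivity : 0 ≤ 2 * β * x)
  have h2 : β * s ≤ q + (2 / β * x * Sd + 2 * β * x * (4 / αP ^ 2 * Sd) + β ^ 2 * (t * q)) := by
    linarith
  have h3 : β * (q / β + t * β * q + x * (2 / β ^ 2 + 8 / αP ^ 2) * Sd)
      = q + (2 / β * x * Sd + 2 * β * x * (4 / αP ^ 2 * Sd) + β ^ 2 * (t * q)) := by
    field_simp
    ring
  exact le_of_mul_le_mul_left (h2.trans h3.ge) hβ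

theorem sum_worker_error_le {β αP αD σ x t Sd Sw Sm Sb : ℝ} (hαD : 0 < αD) (hx : 0 ≤ x)
    (hw : Sw ≤ 4 / αP ^ 2 * Sd)
    (h : αD / 2 * Sb ≤ 6 * β ^ 2 / αD * (Sm + x * Sd + x * Sw)
      + (1 - αD) * β ^ 2 * (t * σ ^ 2)) :
    Sb ≤ 12 * β ^ 2 / αD ^ 2 * (Sm + x * (1 + 4 / αP ^ 2) * Sd)
      + 2 * t * (1 - αD) * β ^ 2 * σ ^ 2 / αD := by
  have h1 := mul_le_mul_of_nonneg_left hw hx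
  have h2 : Sm + x * Sd + x * Sw ≤ Sm + x * (1 + 4 / αP ^ 2) * Sd := by linarith
  have h3 := mul_le_mul_of_nonneg_left h2 (by positivity : 0 ≤ 6 * β ^ 2 / αD)
  have h5 : αD / 2 * (12 * β ^ 2 / αD ^ 2 * (Sm + x * (1 + 4 / αP ^ 2) * Sd)
      + 2 * t * (1 - αD) * β ^ 2 * σ ^ 2 / αD)
      = 6 * β ^ 2 / αD * (Sm + x * (1 + 4 / αP ^ 2) * Sd)
      + (1 - αD) * β ^ 2 * (t * σ ^ 2) := by
    field_simp
    ring
  exact le_of_mul_le_mul_left ((h.trans (add_le_add_left h3 _)).trans h5.ge)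
    (by positivity : 0 < αD / 2)

/-- Under the stepsize restriction, the weight of the squared steps in the sum of the momentum and
compression errors is absorbed by the descent. -/
theorem step_weight_le {ρlo ρhi β αP αD L Λ γ : ℝ} (hρlo : 0 < ρlo) (hαP : 0 < αP) (hαD : 0 < αD)
    (hβ : 0 < β) (hγ : 0 < γ) (hL : 0 ≤ L) (hΛ : 0 ≤ Λ)
    (hγ_le : γ * (2 * √(zeta ρlo ρhi β αP αD L Λ) + 2 * L) ≤ 1) :
    12 * ρhi ^ 2 * (L ^ 2 / ρlo ^ 2 * (2 / β ^ 2 + 8 / αP ^ 2)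
      + 12 * β ^ 2 / αD ^ 2 * (Λ / ρlo ^ 2 * (2 / β ^ 2 + 8 / αP ^ 2)
        + Λ / ρlo ^ 2 * (1 + 4 / αP ^ 2))) ≤ 4 / γ * (1 / (4 * γ) - L / 2) := by
  have hζ : 0 ≤ zeta ρlo ρhi β αP αD L Λ := by
    unfold zeta
    positivity
  -- With z = √ζ, the stepsize condition gives 2γz ≤ 1 - 2Lγ. The right side lies in [0, 1], so
  -- squaring yields 4γ²ζ ≤ 1 - 2Lγ.
  have step : 4 * zeta ρlo ρhi β αP αD L Λ ≤ 4 / γ * (1 / (4 * γ) - L / 2) := by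
    have h1 := Real.sq_sqrt hζ
    have h2 := Real.sqrt_nonneg (zeta ρlo ρhi β αP αD L Λ)
    generalize √(zeta ρlo ρhi β αP αD L Λ) = z at *
    have h3 : 4 / γ * (1 / (4 * γ) - L / 2) = (1 - 2 * L * γ) / γ ^ 2 := by
      field_simp
      ring
    rw [h3, le_div_iff₀ (by positivity), ← h1]
    nlinarith [mul_nonneg hγ.le h2, mul_nonneg hγ.le hL]
  have h1 : 4 * zeta ρlo ρhi β αP αD L Λ - 12 * ρhi ^ 2 *
      (L ^ 2 / ρlo ^ 2 * (2 / β ^ 2 + 8 / αP ^ 2)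
      + 12 * β ^ 2 / αD ^ 2 * (Λ / ρlo ^ 2 * (2 / β ^ 2 + 8 / αP ^ 2)
        + Λ / ρlo ^ 2 * (1 + 4 / αP ^ 2)))
      = ρhi ^ 2 / ρlo ^ 2 * (24 / β ^ 2 * L ^ 2 + 96 * (β + 1) / αP ^ 2 * L ^ 2
        + 288 / αD ^ 2 * Λ + 576 * β ^ 2 * (2 * β + 2) / (αP ^ 2 * αD ^ 2) * Λ) := by
    unfold zeta
    field_simp
    ring
  have h2 : 0 ≤ ρhi ^ 2 / ρlo ^ 2 * (24 / β ^ 2 * L ^ 2 + 96 * (β + 1) / αP ^ 2 * L ^ 2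
        + 288 / αD ^ 2 * Λ + 576 * β ^ 2 * (2 * β + 2) / (αP ^ 2 * αD ^ 2) * Λ) := by
    positivity
  linarith

/-- The momentum noise is obtained with 12 where 24 is claimed, and the slack is a second copy of
those terms. The (1 - αD) term matches exactly. -/
theorem noise_bound_le {κ ν β αD σ γ δ P ρhi : ℝ} (hκ : 0 < κ) (hν : 0 < ν) (hαD : 0 < αD)
    (hβ : 0 < β) (hγ : 0 < γ)
    (h : P ≤ 4 * δ / γ + 12 * ρhi ^ 2 * (σ ^ 2 / ν / β + κ * β * (σ ^ 2 / ν)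
      + 12 * β ^ 2 / αD ^ 2 * (σ ^ 2 / β + κ * β * σ ^ 2)
      + 2 * κ * (1 - αD) * β ^ 2 * σ ^ 2 / αD)) :
    1 / κ * P ≤ 4 * δ / (κ * γ)
        + 24 / κ * (1 / (ν * β) + 12 * β / αD ^ 2) * σ ^ 2 * ρhi ^ 2
        + 24 * (1 / ν + (1 - αD) * β / αD + 12 * β ^ 2 / αD ^ 2) * σ ^ 2 * ρhi ^ 2 * β := by
  rw [one_div, inv_mul_le_iff₀ hκ]
  refine h.trans ?_
  have h1 : κ * (4 * δ / (κ * γ)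
        + 24 / κ * (1 / (ν * β) + 12 * β / αD ^ 2) * σ ^ 2 * ρhi ^ 2
        + 24 * (1 / ν + (1 - αD) * β / αD + 12 * β ^ 2 / αD ^ 2) * σ ^ 2 * ρhi ^ 2 * β)
      - (4 * δ / γ + 12 * ρhi ^ 2 * (σ ^ 2 / ν / β + κ * β * (σ ^ 2 / ν)
      + 12 * β ^ 2 / αD ^ 2 * (σ ^ 2 / β + κ * β * σ ^ 2)
      + 2 * κ * (1 - αD) * β ^ 2 * σ ^ 2 / αD))
      = 12 * ρhi ^ 2 * (σ ^ 2 / ν / β + κ * β * (σ ^ 2 / ν)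
      + 12 * β ^ 2 / αD ^ 2 * (σ ^ 2 / β + κ * β * σ ^ 2)) := by
    field_simp
    ring
  have h2 : 0 ≤ 12 * ρhi ^ 2 * (σ ^ 2 / ν / β + κ * β * (σ ^ 2 / ν)
      + 12 * β ^ 2 / αD ^ 2 * (σ ^ 2 / β + κ * β * σ ^ 2)) := by positivity
  linarith

/-- The n-terms are noise and the x-terms are weights of the summed squared steps; `hcoef` says that
the total weight is covered by the descent surplus. -/
theorem descent_sum_le {γ c q r t cb xa xm xb na nm nb δ P Sa Sb Sm Sd : ℝ} (hγ : 0 < γ)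
    (hd : 0 ≤ Sd) (hr : 0 ≤ r) (hcb : 0 ≤ cb) (hq : q = 12 * r) (ht : t = 4 / γ * c)
    (hP : γ / 4 * P ≤ δ + (3 * γ / 2 * (r * (2 * Sa + 2 * Sb)) - c * Sd))
    (ha : Sa ≤ na + xa * Sd) (hm : Sm ≤ nm + xm * Sd) (hb : Sb ≤ cb * (Sm + xb * Sd) + nb)
    (hcoef : q * (xa + cb * (xm + xb)) ≤ t) :
    P ≤ 4 * δ / γ + q * (na + cb * nm + nb) := by
  subst hq ht
  have h1 := mul_le_mul_of_nonneg_left hP (by positivity : 0 ≤ 4 / γ)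
  have h2 : 4 / γ * (γ / 4 * P) = P := by field_simp
  have h3 : 4 / γ * (δ + (3 * γ / 2 * (r * (2 * Sa + 2 * Sb)) - c * Sd))
      = 4 * δ / γ + 12 * r * (Sa + Sb) - 4 / γ * c * Sd := by
    field_simp
    ring
  have h4 := mul_le_mul_of_nonneg_left hm hcb
  have h5 : Sa + Sb ≤ na + cb * nm + nb + (xa + cb * (xm + xb)) * Sd := by linarith
  have h6 := mul_le_mul_of_nonneg_left h5 (by positivity : 0 ≤ 12 * r)
  have h7 := mul_le_mul_of_nonneg_right hcoef hd
  linarith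

theorem rate_of_recursions {n : ℕ} (hn : 1 ≤ n) {ρlo ρhi β αP αD L Λ σ γ δ P : ℝ}
    {d w a m b : ℕ → ℝ} {K : ℕ} (hK : 1 ≤ K) (hρlo : 0 < ρlo)
    (hαP : 0 < αP ∧ αP ≤ 1) (hαD : 0 < αD) (hβ : 0 < β) (hγ : 0 < γ)
    (hL : 0 ≤ L) (hΛ : 0 ≤ Λ)
    (hγ_le : γ * (2 * √(zeta ρlo ρhi β αP αD L Λ) + 2 * L) ≤ 1)
    (hd : ∀ k, 0 ≤ d k) (hw : ∀ k, 0 ≤ w k) (ha : ∀ k, 0 ≤ a k) (hm : ∀ k, 0 ≤ m k)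
    (hb : ∀ k, 0 ≤ b k) (hw0 : w 0 = 0) (ha0 : a 0 ≤ σ ^ 2 / n) (hm0 : m 0 ≤ σ ^ 2)
    (hb0 : b 0 = 0)
    (hwk : ∀ k, w (k + 1) ≤ (1 - αP / 2) * w k + 2 / αP * d k)
    (hak : ∀ k, a (k + 1) ≤ (1 - β) * a k + (2 / β * (L ^ 2 / ρlo ^ 2) * d k
      + 2 * β * (L ^ 2 / ρlo ^ 2) * w (k + 1) + β ^ 2 * (σ ^ 2 / n)))
    (hmk : ∀ k, m (k + 1) ≤ (1 - β) * m k + (2 / β * (Λ / ρlo ^ 2) * d k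
      + 2 * β * (Λ / ρlo ^ 2) * w (k + 1) + β ^ 2 * σ ^ 2))
    (hbk : ∀ k, b (k + 1) ≤ (1 - αD / 2) * b k + (6 * β ^ 2 / αD * (m k
      + Λ / ρlo ^ 2 * d k + Λ / ρlo ^ 2 * w (k + 1)) + (1 - αD) * β ^ 2 * σ ^ 2))
    (hP : γ / 4 * P ≤ δ + ∑ k ∈ Finset.range K, (3 * γ / 2 * (ρhi ^ 2 * (2 * a k + 2 * b k))
      - (1 / (4 * γ) - L / 2) * d k)) :
    1 / (K : ℝ) * P ≤ 4 * δ / (K * γ)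
        + 24 / K * (1 / (n * β) + 12 * β / αD ^ 2) * σ ^ 2 * ρhi ^ 2
        + 24 * (1 / n + (1 - αD) * β / αD + 12 * β ^ 2 / αD ^ 2) * σ ^ 2 * ρhi ^ 2 * β := by
  have hn' : (0 : ℝ) < n := by exact_mod_cast hn
  have hK' : (0 : ℝ) < K := by exact_mod_cast hK
  have rw := sum_add_le_of_contraction hwk K
  have ra := sum_add_le_of_contraction hak K
  have rm := sum_add_le_of_contraction hmk K
  have rb := sum_add_le_of_contraction hbk K
  have hws := (Finset.sum_range_succ w K).symm.trans (Finset.sum_range_succ' w K)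
  simp only [Finset.sum_add_distrib, Finset.sum_sub_distrib, ← Finset.mul_sum, Finset.sum_const,
    Finset.card_range, nsmul_eq_mul] at rw ra rm rb hP
  have nd : 0 ≤ ∑ k ∈ Finset.range K, d k := Finset.sum_nonneg fun k _ => hd k
  rw [hw0, add_zero] at hws
  have sw : ∑ k ∈ Finset.range K, w (k + 1) ≤ 4 / αP ^ 2 * ∑ k ∈ Finset.range K, d k := by
    have hαP0 := hαP.1
    have h1 : αP / 2 * ∑ k ∈ Finset.range K, w (k + 1)
        ≤ 2 / αP * ∑ k ∈ Finset.range K, d k := by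
      -- The sum is shifted by one index because gradients are taken at W^{k+1}. The extra last term
      -- is paid for by the w_K that the summed recursion retains, and w_0 = 0.
      have h2 := mul_le_mul_of_nonneg_right (by linarith [hαP.2] : αP / 2 ≤ 1) (hw K)
      rw [hw0] at rw
      rw [← hws, mul_add]
      linarith
    have h3 : αP / 2 * (4 / αP ^ 2 * ∑ k ∈ Finset.range K, d k)
        = 2 / αP * ∑ k ∈ Finset.range K, d k := by
      field_simp
      ring
    exact le_of_mul_le_mul_left (h1.trans h3.ge) (by positivity : 0 < αP / 2)
  have sa := sum_momentum_le hβ hαP.1 (by positivity : 0 ≤ L ^ 2 / ρlo ^ 2) sw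
    (((le_add_of_nonneg_right (ha K)).trans ra).trans (add_le_add_left ha0 _))
  have sm := sum_momentum_le hβ hαP.1 (by positivity : 0 ≤ Λ / ρlo ^ 2) sw
    (((le_add_of_nonneg_right (hm K)).trans rm).trans (add_le_add_left hm0 _))
  rw [hb0, zero_add] at rb
  have sb := sum_worker_error_le hαD (by positivity : 0 ≤ Λ / ρlo ^ 2) sw
    ((le_add_of_nonneg_right (hb K)).trans rb)
  exact noise_bound_le hK' hn' hαD hβ hγ (descent_sum_le hγ nd (sq_nonneg ρhi) (by positivity) rfl
    rfl hP sa sm sb (step_weight_le hρlo hαP.1 hαD hβ hγ hL hΛ hγ_le))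

/-! ### Assembling the rate. -/

section Run

variable {S : Type*} [NormedAddCommGroup S] [InnerProductSpace ℝ S] [FiniteDimensional ℝ S]
  [CompleteSpace S] [MeasurableSpace S] [BorelSpace S]
  {Ω : Type*} [mΩ : MeasurableSpace Ω] {μ : Measure Ω} [IsProbabilityMeasure μ]
  {n : ℕ} {Ξ : Fin n → Type*} [∀ j, MeasurableSpace (Ξ j)]
  {U V : ℕ → Type*} [∀ k, MeasurableSpace (U k)] [∀ k, MeasurableSpace (V k)]
  {D : ∀ j, Measure (Ξ j)} {νU : ∀ k, Measure (U k)} {νV : ∀ k, Measure (V k)}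
  {ξ : ℕ → ∀ j, Ω → Ξ j} {η : ∀ k, Ω → U k} {θ : ∀ k, Ω → V k}
  {N : Seminorm ℝ S} {ρlo ρhi : ℝ} {f : Fin n → S → ℝ} {L : ℝ} {Lj : Fin n → ℝ} {σ : ℝ}
  {g : ∀ j, S → Ξ j → S} {αP αD : ℝ} {C : ∀ k, S → U k → S} {Cw : ∀ k, Fin n → S → V k → S}
  {β γ : ℝ} {X₀ : S} {X W : ℕ → Ω → S} {M G : ℕ → Fin n → Ω → S}

namespace Setting

theorem integrable_dualNorm_gradient_sq
    (h : Setting μ D νU νV ξ η θ N ρlo ρhi f L Lj σ g αP αD C Cw β γ X₀ X W M G) (k : ℕ) :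
    Integrable (fun ω => dualNorm N (gradient (objective f) (X k ω)) ^ 2) μ := by
  have hX := h.memLp_gradient_comp h.L_nonneg h.smooth (h.memLp_iterates k).1
  refine (hX.norm.integrable_sq.const_mul (ρhi ^ 2)).mono'
    (((continuous_dualNorm h.ρhi_pos h.hi).comp_aestronglyMeasurable hX.1).pow 2)
    (Filter.Eventually.of_forall fun ω => ?_)
  rw [Real.norm_of_nonneg (by positivity), ← mul_pow]
  exact pow_le_pow_left₀ (dualNorm_nonneg h.ρhi_pos h.hi _)
    (dualNorm_le_mul_norm h.ρhi_pos h.hi _) 2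

omit [FiniteDimensional ℝ S] [BorelSpace S] [IsProbabilityMeasure μ] in
theorem dualNorm_estimator_error_sq_le
    (h : Setting μ D νU νV ξ η θ N ρlo ρhi f L Lj σ g αP αD C Cw β γ X₀ X W M G) (k : ℕ) (ω : Ω) :
    dualNorm N (gradient (objective f) (X k ω) - serverEstimator G k ω) ^ 2
      ≤ ρhi ^ 2 * (2 * ‖serverEstimator M k ω - gradient (objective f) (X k ω)‖ ^ 2
        + 2 * ((n : ℝ)⁻¹ * ∑ j, ‖G k j ω - M k j ω‖ ^ 2)) := by
  have h1 := pow_le_pow_left₀ (dualNorm_nonneg h.ρhi_pos h.hi _) (dualNorm_le_mul_norm h.ρhi_pos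
    h.hi (gradient (objective f) (X k ω) - serverEstimator G k ω)) 2
  have h2 : ‖gradient (objective f) (X k ω) - serverEstimator G k ω‖
      ≤ ‖serverEstimator M k ω - gradient (objective f) (X k ω)‖
        + ‖(n : ℝ)⁻¹ • ∑ j, (G k j ω - M k j ω)‖ := by
    rw [← norm_neg]
    refine le_trans (le_of_eq ?_) (norm_add_le _ _)
    rw [Finset.sum_sub_distrib, smul_sub]
    simp only [serverEstimator]
    congr 1
    abel
  have h3 := norm_inv_smul_sum_sq_le h.one_le fun j => G k j ω - M k j ω
  rw [mul_pow] at h1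
  refine h1.trans (mul_le_mul_of_nonneg_left ?_ (sq_nonneg ρhi))
  refine (pow_le_pow_left₀ (norm_nonneg _) h2 2).trans ?_
  generalize ‖serverEstimator M k ω - gradient (objective f) (X k ω)‖ = x at *
  generalize ‖(n : ℝ)⁻¹ • ∑ j, (G k j ω - M k j ω)‖ = y at *
  nlinarith [sq_nonneg (x - y)]

omit [FiniteDimensional ℝ S] [BorelSpace S] [IsProbabilityMeasure μ] in
-- Telescoping is done pathwise, before taking expectations, so integrability of f(X^k) is never
-- needed: only f(X^K) survives, and it is then replaced by its lower bound.
theorem sum_dualNorm_gradient_sq_le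
    (h : Setting μ D νU νV ξ η θ N ρlo ρhi f L Lj σ g αP αD C Cw β γ X₀ X W M G) (K : ℕ) (ω : Ω) :
    ∑ k ∈ Finset.range K, γ / 4 * dualNorm N (gradient (objective f) (X k ω)) ^ 2
      ≤ objective f X₀ - objective f (X K ω) + ∑ k ∈ Finset.range K,
        (3 * γ / 2 * (ρhi ^ 2 * (2 * ‖serverEstimator M k ω - gradient (objective f) (X k ω)‖ ^ 2
          + 2 * ((n : ℝ)⁻¹ * ∑ j, ‖G k j ω - M k j ω‖ ^ 2)))
        - (1 / (4 * γ) - L / 2) * N (X (k + 1) ω - X k ω) ^ 2) := by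
  induction K with
  | zero => simp [h.run.X_zero]
  | succ K ih =>
    rw [Finset.sum_range_succ, Finset.sum_range_succ]
    have h1 := h.smooth.lmo_step h.ρhi_pos h.hi h.γ_pos (h.run.X_succ K ω)
    have h2 := mul_le_mul_of_nonneg_left (h.dualNorm_estimator_error_sq_le K ω)
      (by linarith [h.γ_pos] : 0 ≤ 3 * γ / 2)
    linarith

theorem sum_integral_dualNorm_gradient_sq_le
    (h : Setting μ D νU νV ξ η θ N ρlo ρhi f L Lj σ g αP αD C Cw β γ X₀ X W M G) {fstar : ℝ}
    (hfstar : ∀ X : S, fstar ≤ objective f X) (K : ℕ) :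
    γ / 4 * ∑ k ∈ Finset.range K, ∫ ω, dualNorm N (gradient (objective f) (X k ω)) ^ 2 ∂μ
      ≤ objective f X₀ - fstar + ∑ k ∈ Finset.range K,
        (3 * γ / 2 * (ρhi ^ 2 *
          (2 * ∫ ω, ‖serverEstimator M k ω - gradient (objective f) (X k ω)‖ ^ 2 ∂μ
          + 2 * ((n : ℝ)⁻¹ * ∑ j, ∫ ω, ‖G k j ω - M k j ω‖ ^ 2 ∂μ)))
        - (1 / (4 * γ) - L / 2) * ∫ ω, N (X (k + 1) ω - X k ω) ^ 2 ∂μ) := by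
  have i0 := fun k => (h.integrable_dualNorm_gradient_sq k).const_mul (γ / 4)
  have ia : ∀ k, Integrable
      (fun ω => ‖serverEstimator M k ω - gradient (objective f) (X k ω)‖ ^ 2) μ := fun k =>
    ((memLp_serverEstimator k (h.memLp_iterates k).2.2.1).sub
      (h.memLp_gradient_comp h.L_nonneg h.smooth (h.memLp_iterates k).1)).norm.integrable_sq
  have ib : ∀ k j, Integrable (fun ω => ‖G k j ω - M k j ω‖ ^ 2) μ := fun k j =>
    (((h.memLp_iterates k).2.2.2 j).sub ((h.memLp_iterates k).2.2.1 j)).norm.integrable_sq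
  have ibs : ∀ k, Integrable (fun ω => (n : ℝ)⁻¹ * ∑ j, ‖G k j ω - M k j ω‖ ^ 2) μ := fun k =>
    (integrable_finsetSum _ fun j _ => ib k j).const_mul _
  have id : ∀ k, Integrable (fun ω => N (X (k + 1) ω - X k ω) ^ 2) μ := fun k =>
    integrable_seminorm_sq h.lo h.ρlo_pos ((h.memLp_iterates (k + 1)).1.sub (h.memLp_iterates k).1)
  have iab : ∀ k, Integrable (fun ω =>
      2 * ‖serverEstimator M k ω - gradient (objective f) (X k ω)‖ ^ 2
        + 2 * ((n : ℝ)⁻¹ * ∑ j, ‖G k j ω - M k j ω‖ ^ 2)) μ := fun k =>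
    ((ia k).const_mul 2).add ((ibs k).const_mul 2)
  have iq : ∀ k, Integrable (fun ω =>
      3 * γ / 2 * (ρhi ^ 2 * (2 * ‖serverEstimator M k ω - gradient (objective f) (X k ω)‖ ^ 2
        + 2 * ((n : ℝ)⁻¹ * ∑ j, ‖G k j ω - M k j ω‖ ^ 2)))
      - (1 / (4 * γ) - L / 2) * N (X (k + 1) ω - X k ω) ^ 2) μ := fun k =>
    (((iab k).const_mul _).const_mul _).sub ((id k).const_mul _)
  have h1 := integral_mono (integrable_finsetSum (Finset.range K) fun k _ => i0 k)
    ((integrable_const (objective f X₀ - fstar)).add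
      (integrable_finsetSum (Finset.range K) fun k _ => iq k))
    (fun ω => (h.sum_dualNorm_gradient_sq_le K ω).trans
      (add_le_add_left (sub_le_sub_left (hfstar (X K ω)) _) _))
  simp only [Pi.add_apply] at h1
  rw [integral_add (integrable_const _) (integrable_finsetSum _ fun k _ => iq k),
    integral_finsetSum _ fun k _ => i0 k, integral_finsetSum _ fun k _ => iq k, integral_const,
    probReal_univ, one_smul] at h1
  simp only [integral_const_mul] at h1
  rw [Finset.mul_sum]
  refine h1.trans (le_of_eq ?_)
  congr 1
  refine Finset.sum_congr rfl fun k _ => ?_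
  rw [integral_sub (((iab k).const_mul _).const_mul _) ((id k).const_mul _), integral_const_mul,
    integral_const_mul, integral_const_mul, integral_add ((ia k).const_mul 2)
    ((ibs k).const_mul 2), integral_const_mul, integral_const_mul, integral_const_mul,
    integral_finsetSum _ fun j _ => ib k j]

theorem average_integral_dualNorm_gradient_sq_le
    (h : Setting μ D νU νV ξ η θ N ρlo ρhi f L Lj σ g αP αD C Cw β γ X₀ X W M G) {fstar : ℝ}
    (hfstar : ∀ X : S, fstar ≤ objective f X)
    (hγ_le : γ * (2 * √(zeta ρlo ρhi β αP αD L ((n : ℝ)⁻¹ * ∑ j, Lj j ^ 2)) + 2 * L) ≤ 1)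
    {K : ℕ} (hK : 1 ≤ K) :
    (1 / (K : ℝ)) * ∑ k ∈ Finset.range K,
        ∫ ω, dualNorm N (gradient (objective f) (X k ω)) ^ 2 ∂μ
      ≤ 4 * (objective f X₀ - fstar) / (K * γ)
        + 24 / K * (1 / (n * β) + 12 * β / αD ^ 2) * σ ^ 2 * ρhi ^ 2
        + 24 * (1 / n + (1 - αD) * β / αD + 12 * β ^ 2 / αD ^ 2) * σ ^ 2 * ρhi ^ 2 * β := by
  refine rate_of_recursions h.one_le hK h.ρlo_pos ⟨h.αP_pos, h.αP_le⟩ h.αD_pos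
    h.β_pos h.γ_pos h.L_nonneg (by positivity) hγ_le
    (d := fun k => ∫ ω, N (X (k + 1) ω - X k ω) ^ 2 ∂μ)
    (w := fun k => ∫ ω, N (W k ω - X k ω) ^ 2 ∂μ)
    (a := fun k => ∫ ω, ‖serverEstimator M k ω - gradient (objective f) (X k ω)‖ ^ 2 ∂μ)
    (m := fun k => (n : ℝ)⁻¹ * ∑ j, ∫ ω, ‖M k j ω - gradient (f j) (X k ω)‖ ^ 2 ∂μ)
    (b := fun k => (n : ℝ)⁻¹ * ∑ j, ∫ ω, ‖G k j ω - M k j ω‖ ^ 2 ∂μ)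
    (fun k => integral_nonneg fun ω => by positivity)
    (fun k => integral_nonneg fun ω => by positivity)
    (fun k => integral_nonneg fun ω => by positivity)
    (fun k => mul_nonneg (by positivity) (Finset.sum_nonneg fun j _ =>
      integral_nonneg fun ω => by positivity))
    (fun k => mul_nonneg (by positivity) (Finset.sum_nonneg fun j _ =>
      integral_nonneg fun ω => by positivity))
    ?_ h.integral_server_momentum_zero_le ?_ ?_ h.integral_server_error_le (fun k => ?_)
    (fun k => ?_) (fun k => ?_) (h.sum_integral_dualNorm_gradient_sq_le hfstar K)
  · simp [h.run.X_zero, h.run.W_zero]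
  · have := average_le h.one_le (x := fun _ => 0) (y := fun _ => 0) (l := fun _ => 0) (A := 0)
      (B := 0) (E := 0) (Q := σ ^ 2) (fun j =>
        (h.integral_worker_momentum_zero_le j).trans (by simp))
    simpa using this
  · simp [h.run.G_zero, h.run.M_zero]
  · refine (h.integral_server_momentum_le k).trans (le_of_eq ?_)
    ring
  -- The step and server errors do not depend on j, so they go into the coefficient of Lj²;
  -- averaging then produces L̃².
  · have := average_le h.one_le (l := fun j => Lj j ^ 2) (A := 1 - β) (B := 0)
      (x := fun j => ∫ ω, ‖M k j ω - gradient (f j) (X k ω)‖ ^ 2 ∂μ) (y := fun _ => 0)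
      (E := 2 / β * (1 / ρlo ^ 2) * ∫ ω, N (X (k + 1) ω - X k ω) ^ 2 ∂μ
        + 2 * β * (1 / ρlo ^ 2) * ∫ ω, N (W (k + 1) ω - X (k + 1) ω) ^ 2 ∂μ)
      (Q := β ^ 2 * σ ^ 2)
      (fun j => (h.integral_worker_momentum_le k j).trans (le_of_eq (by ring)))
    refine this.trans (le_of_eq ?_)
    ring
  · have := average_le h.one_le (l := fun j => Lj j ^ 2) (A := 1 - αD / 2)
      (x := fun j => ∫ ω, ‖G k j ω - M k j ω‖ ^ 2 ∂μ)
      (B := 6 * β ^ 2 / αD) (y := fun j => ∫ ω, ‖M k j ω - gradient (f j) (X k ω)‖ ^ 2 ∂μ)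
      (E := 6 * β ^ 2 / αD * (1 / ρlo ^ 2 * ∫ ω, N (X (k + 1) ω - X k ω) ^ 2 ∂μ
        + 1 / ρlo ^ 2 * ∫ ω, N (W (k + 1) ω - X (k + 1) ω) ^ 2 ∂μ))
      (Q := (1 - αD) * β ^ 2 * σ ^ 2)
      (fun j => (h.integral_worker_error_le k j).trans (le_of_eq (by ring)))
    refine this.trans (le_of_eq ?_)
    ring

end Setting

end Run

end EF21Muon

theorem mainTheorem7
    {S : Type*} [NormedAddCommGroup S] [InnerProductSpace ℝ S] [FiniteDimensional ℝ S]
    [CompleteSpace S] [MeasurableSpace S] [BorelSpace S]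
    {Ω : Type*} [MeasurableSpace Ω] (μ : Measure Ω) [IsProbabilityMeasure μ]
    {n : ℕ} (hn : 1 ≤ n)
    {Ξ : Fin n → Type*} [∀ j, MeasurableSpace (Ξ j)]
    {U V : ℕ → Type*} [∀ k, MeasurableSpace (U k)] [∀ k, MeasurableSpace (V k)]
    (D : ∀ j, Measure (Ξ j)) (νU : ∀ k, Measure (U k)) (νV : ∀ k, Measure (V k))
    (ξ : ℕ → ∀ j, Ω → Ξ j) (η : ∀ k, Ω → U k) (θ : ∀ k, Ω → V k)
    (hrand : EF21Muon.IsRandomness μ D νU νV ξ η θ)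
    -- the (arbitrary) norm and the norm equivalence constants
    (N : Seminorm ℝ S) (ρlo ρhi : ℝ) (hρlo : 0 < ρlo) (hρhi : 0 < ρhi)
    (hN : ∀ X : S, ρlo * N X ≤ ‖X‖ ∧ ‖X‖ ≤ ρhi * N X)
    -- lower boundedness, smoothness, stochastic gradients
    (f : Fin n → S → ℝ) (fstar : ℝ) (hfstar : ∀ X : S, fstar ≤ EF21Muon.objective f X)
    (L : ℝ) (hL : 0 ≤ L) (hf : EF21Muon.IsSmooth N L (EF21Muon.objective f))
    (Lj : Fin n → ℝ) (hLj : ∀ j, 0 ≤ Lj j) (hfj : ∀ j, EF21Muon.IsSmooth N (Lj j) (f j))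
    (σ : ℝ) (hσ : 0 ≤ σ) (g : ∀ j, S → Ξ j → S)
    (hg : ∀ j, EF21Muon.IsOracle σ (D j) (f j) (g j))
    -- compressors
    (αP αD : ℝ) (hαP : 0 < αP ∧ αP ≤ 1) (hαD : 0 < αD ∧ αD ≤ 1)
    (C : ∀ k, S → U k → S) (hC : ∀ k, EF21Muon.IsCompressor N αP (νU k) (C k))
    (Cw : ∀ k, Fin n → S → V k → S)
    (hCw : ∀ k j, EF21Muon.IsCompressor (normSeminorm ℝ S) αD (νV k) (Cw k j))
    -- momentum and stepsize
    (β : ℝ) (hβ : 0 < β ∧ β ≤ 1) (γ : ℝ) (hγ : 0 < γ)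
    (hγ_le : γ * (2 * √(EF21Muon.zeta ρlo ρhi β αP αD L ((n : ℝ)⁻¹ * ∑ j, Lj j ^ 2)) + 2 * L) ≤ 1)
    -- the iterates
    (X₀ : S) (X W : ℕ → Ω → S) (M G : ℕ → Fin n → Ω → S)
    (hrun : EF21Muon.IsRun N β γ X₀ g C Cw ξ η θ X W M G)
    (K : ℕ) (hK : 1 ≤ K) :
    (∀ k < K, Integrable
      (fun ω => EF21Muon.dualNorm N (gradient (EF21Muon.objective f) (X k ω)) ^ 2) μ) ∧
    (1 / (K : ℝ)) * ∑ k ∈ Finset.range K,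
        ∫ ω, EF21Muon.dualNorm N (gradient (EF21Muon.objective f) (X k ω)) ^ 2 ∂μ
      ≤ 4 * (EF21Muon.objective f X₀ - fstar) / (K * γ)
        + 24 / K * (1 / (n * β) + 12 * β / αD ^ 2) * σ ^ 2 * ρhi ^ 2
        + 24 * (1 / n + (1 - αD) * β / αD + 12 * β ^ 2 / αD ^ 2) * σ ^ 2 * ρhi ^ 2 * β := by
  have h : EF21Muon.Setting μ D νU νV ξ η θ N ρlo ρhi f L Lj σ g αP αD C Cw β γ X₀ X W M G :=
    ⟨hrand, hn, hρlo, hρhi, fun X => (hN X).1, fun X => (hN X).2, hL, hf, hLj, hfj, hg, hαP.1,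
      hαP.2, hαD.1, hαD.2, hC, hCw, hβ.1, hβ.2, hγ, hrun⟩
  exact ⟨fun k _ => h.integrable_dualNorm_gradient_sq k,
    h.average_integral_dualNorm_gradient_sq_le hfstar hγ_le hK⟩
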